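/- Let $d\ge 1$, let $F$ be a probability distribution on $(0,R_{\max}]$ with $R_{\max}<\infty$, and let $\mathcal P$ be a homogeneous Poisson point process of unit intensity on $\mathbb R^d\times[0,\infty)$ whose points $(X,T)$ carry independent marks $r$ with distribution $F$. Let $(Q_n)$ be finite subsets of $\mathbb Z^d$ such that every $z\in\mathbb Z^d$ belongs to $Q_n$ for all large $n$, put $\tilde Q_n:=Q_n\oplus[0,1)^d$, and for $t\ge 0$ let $\mathcal P_{t,n}$ be the set of the (marked) points of $\mathcal P$ in $\tilde Q_n\times[0,t]$. Given an initial set $A_0\subset\mathbb R^d\times\mathbb R$, let the points of $\mathcal P_{t,n}$ arrive in order of increasing time. A point $(X,T)$ with mark $r$ is a closed Euclidean ball of radius $r$ in $\mathbb R^{d+1}$ whose centre moves down the vertical line $\{X\}\times\mathbb R$ from above; it stops for ever when it first meets the current agglomeration ($A_0$ together with all earlier stopped balls), and it has no effect if it misses the agglomeration. The height above $x$ of the agglomeration $A$ so obtained is $\sup\{h:(x,h)\in A\}$, with $\sup\emptyset=-\infty$. Denote this height by $H_{t,n}(x)$ if $A_0=\tilde Q_n\times\{0\}$ (flat substrate),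 and by $\hat H_{t,n}(x)$ if $A_0=\{(\mathbf 0,0)\}$ (single seed point at the origin). Put $$H_t(\mathbf 0)=\lim_{n\to\infty}H_{t,n}(\mathbf 0),\qquad \hat H_t(x)=\lim_{n\to\infty}\hat H_{t,n}(x)\quad(x\in\mathbb R^d),\qquad \tilde D_t=\sup_{x\in\mathbb R^d}\hat H_t(x).$$ Then for every $t\ge 0$ the first limit almost surely exists and is finite; almost surely the second limit exists in $[-\infty,\infty]$ for all $x\in\mathbb R^d$ simultaneously; and the random variables $H_t(\mathbf 0)$ and $\tilde D_t$ have the same distribution. -/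

import Mathlib

open MeasureTheory ProbabilityTheory Filter Topology
open scoped ENNReal NNReal

noncomputable section

namespace BallisticDeposition

/-- `P` is a Poisson point process on `α` with intensity measure `Λ`, given as a random set of
points. The number of points in each measurable set is a random variable, it is Poisson with
parameter `Λ B` (infinite if `Λ B = ∞`), and the numbers of points in disjoint sets are independent.
(A random set has no multiple points, as is right for the intensities without atoms used here.) -/
structure IsPoissonProcess {α Ω : Type*} [MeasurableSpace α] [MeasurableSpace Ω]
    (μ : Measure Ω) (Λ : Measure α) (P : Ω → Set α) : Prop where
  measurable_count : ∀ B : Set α, MeasurableSet B → Measurable fun ω => (P ω ∩ B).encard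
  count_law : ∀ B : Set α, MeasurableSet B → Λ B ≠ ∞ →
    μ.map (fun ω => (P ω ∩ B).encard)
      = (poissonMeasure (Λ B).toNNReal).map (fun k : ℕ => (k : ℕ∞))
  count_top : ∀ B : Set α, MeasurableSet B → Λ B = ∞ → ∀ᵐ ω ∂μ, (P ω ∩ B).encard = ⊤
  indep : ∀ (k : ℕ) (B : Fin k → Set α), (∀ i, MeasurableSet (B i)) →
    Pairwise (fun i j => Disjoint (B i) (B j)) →
    iIndepFun (fun (i : Fin k) ω => (P ω ∩ B i).encard) μ

/-- The space `ℝ^d` of horizontal positions, with the Euclidean norm. -/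
abbrev Space (d : ℕ) : Type := EuclideanSpace ℝ (Fin d)

/-- A marked space-time point `(X, T, r)`: horizontal position `X` of the centre, time `T` of
arrival, radius `r`. -/
abbrev Particle (d : ℕ) : Type := Space d × ℝ × ℝ

namespace Particle

/-- Horizontal position of the centre. -/
def loc {d : ℕ} (p : Particle d) : Space d := p.1

/-- Arrival time. -/
def time {d : ℕ} (p : Particle d) : ℝ := p.2.1

/-- Radius (the mark). -/
def radius {d : ℕ} (p : Particle d) : ℝ := p.2.2

end Particle

/-- Intensity of the homogeneous Poisson process of unit rate on `ℝ^d × [0, ∞)` whose points carry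
independent marks of distribution `F`: the product of Lebesgue measure on `ℝ^d × [0, ∞)` with `F`. -/
def intensity (d : ℕ) (F : Measure ℝ) : Measure (Particle d) :=
  (volume : Measure (Space d)).prod (((volume : Measure ℝ).restrict (Set.Ici 0)).prod F)

/-- The closed Euclidean ball of radius `r` (for `r ≥ 0`) in `ℝ^{d+1} = ℝ^d × ℝ`, with centre at
horizontal position `X` and height `c`. -/
def solidBall {d : ℕ} (X : Space d) (c r : ℝ) : Set (Space d × ℝ) :=
  {y | dist y.1 X ^ 2 + (y.2 - c) ^ 2 ≤ r ^ 2}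

/-- The heights of the centre at which the particle `p`, moving along the vertical line above its
position, meets the set `A`. -/
def contactHeights {d : ℕ} (A : Set (Space d × ℝ)) (p : Particle d) : Set ℝ :=
  {c | (solidBall p.loc c p.radius ∩ A).Nonempty}

open Classical in
/-- One deposition: `p` falls vertically from above and sticks where it first meets `A` (at the
largest contact height). If it misses `A`, it has no effect. -/
def deposit {d : ℕ} (A : Set (Space d × ℝ)) (p : Particle d) : Set (Space d × ℝ) :=
  if (contactHeights A p).Nonempty then
    A ∪ solidBall p.loc (sSup (contactHeights A p)) p.radius
  else A

/-- The agglomeration after the particles of the list have been deposited, in this order, onto the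
initial set `A`. -/
def agglomeration {d : ℕ} (A : Set (Space d × ℝ)) (l : List (Particle d)) : Set (Space d × ℝ) :=
  l.foldl deposit A

/-- The particles of `P` with position in `W` and arrival time in `[0, t]`. -/
def restriction {d : ℕ} (P : Set (Particle d)) (W : Set (Space d)) (t : ℝ) : Set (Particle d) :=
  {p ∈ P | p.loc ∈ W ∧ 0 ≤ p.time ∧ p.time ≤ t}

open Classical in
/-- The particles of a finite set, listed in order of increasing arrival time. (For the sets used
here, finiteness and the absence of ties hold almost surely.) -/
def arrivals {d : ℕ} (S : Set (Particle d)) : List (Particle d) :=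
  if h : S.Finite then h.toFinset.toList.insertionSort (fun p q => p.time ≤ q.time) else []

/-- The height of a set above the point `x`, that is `sup {h | (x, h) ∈ A}`; it is `-∞` if no point
of `A` lies above `x`. -/
def heightAbove {d : ℕ} (A : Set (Space d × ℝ)) (x : Space d) : EReal :=
  ⨆ h ∈ {h : ℝ | (x, h) ∈ A}, (h : EReal)

/-- The region `Q ⊕ [0,1)^d` for a finite set `Q` of lattice points. -/
def cubes {d : ℕ} (Q : Finset (Fin d → ℤ)) : Set (Space d) :=
  {x | ∃ z ∈ Q, ∀ i, (z i : ℝ) ≤ x i ∧ x i < z i + 1}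

/-- The flat substrate `W × {0}`. -/
def flat {d : ℕ} (W : Set (Space d)) : Set (Space d × ℝ) := W ×ˢ {0}

/-- The single seed point at the origin of `ℝ^{d+1}`, whose height profile is `0` at the origin of
`ℝ^d` and `-∞` elsewhere. -/
def seed (d : ℕ) : Set (Space d × ℝ) := {(0, 0)}

/-- `H_{t,n}(x)`: height at time `t` above `x` for deposition onto the flat substrate over
`cubes (Q n)`, driven by the particles of `P` with position in `cubes (Q n)`. -/
def flatHeight {d : ℕ} (Q : ℕ → Finset (Fin d → ℤ)) (P : Set (Particle d)) (t : ℝ) (n : ℕ)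
    (x : Space d) : EReal :=
  heightAbove (agglomeration (flat (cubes (Q n))) (arrivals (restriction P (cubes (Q n)) t))) x

/-- The same with the flat substrate replaced by the seed. -/
def seedHeight {d : ℕ} (Q : ℕ → Finset (Fin d → ℤ)) (P : Set (Particle d)) (t : ℝ) (n : ℕ)
    (x : Space d) : EReal :=
  heightAbove (agglomeration (seed d) (arrivals (restriction P (cubes (Q n)) t))) x

/-- `H_t(x)`, the height above `x` for the flat infinite substrate: the limit of `H_{t,n}(x)` as
`n → ∞`. (Written as an upper limit, which is the limit where that exists.) -/
def infiniteFlatHeight {d : ℕ} (Q : ℕ → Finset (Fin d → ℤ)) (P : Set (Particle d)) (t : ℝ)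
    (x : Space d) : EReal :=
  limsup (fun n => flatHeight Q P t n x) atTop

/-- The dual height `Ĥ_t(x)`: the limit as `n → ∞` of the heights grown from the seed. (Written as
an upper limit, which is the limit where that exists.) -/
def infiniteSeedHeight {d : ℕ} (Q : ℕ → Finset (Fin d → ℤ)) (P : Set (Particle d)) (t : ℝ)
    (x : Space d) : EReal :=
  limsup (fun n => seedHeight Q P t n x) atTop

/-- `D̃_t`, the maximum height at time `t` of the deposit grown from the seed. -/
def seedDepth {d : ℕ} (Q : ℕ → Finset (Fin d → ℤ)) (P : Set (Particle d)) (t : ℝ) : EReal :=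
  ⨆ x : Space d, infiniteSeedHeight Q P t x

end BallisticDeposition

end

/-!
In terms of the height `contact A p` at which the centre of a falling ball `p` comes to rest on `A`,
a deposition is linear over the max-plus semiring: by `contact_deposit`,
`contact (deposit A q) p = contact A p ⊔ (contact A q + link q p)`, where `link q p` is the height
of `p` above `q` when `p` rests on `q`. Hence a height of the agglomeration is the supremum, over the
chains of particles with increasing arrival times, of the sum of an initial weight, the links, and a
final weight (`chainSup`). For the flat substrate seen above the origin the initial weight is the
radius and the final weight is the link to the origin; for the maximal height grown from the seed the
two weights are exchanged. Since `link` is symmetric, reversal of the order of the particles turns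
the first quantity into the second (`chainSup_reverse`, `heightAbove_flat_eq_iSup_seed`).

Only the particles that are joined to the origin by a chain with increasing arrival times matter for
the deposit grown from the seed. Almost surely there are finitely many of them: `[0, t]` is cut into
thin time slabs, in each of which the occupied unit cells form a subcritical percolation process,
because the expected number of self-avoiding occupied paths of length `k` from a given cell is at
most `2⁻ᵏ` (`ae_finite_cluster`, `finite_reached`). So the heights grown from the seed are eventually
constant in `n`, at all positions at once, and by duality applied to the time-reversed process so is
the flat height above the origin.

Thus almost surely `H_t(0)` is the dual depth of the process reversed in time on `[0, t]`. The
reversed process is again Poisson with the same intensity. The law of a Poisson process on the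
σ-algebra generated by the counts is determined by the intensity (`map_config_eq`), and on regular
configurations the dual depth agrees with a function that is measurable for this σ-algebra
(`measurable_measurableDepth`), which gives the equality of the distributions.
-/

noncomputable section

namespace BallisticDeposition

/-! ### Deposition as a max-plus linear operation, and duality -/

/-- The amount by which the centre of a ball `p`, resting on a placed ball `q`, lies above the
centre of `q`; it is `-∞` if `p` misses `q`. -/
def link {d : ℕ} (q p : Particle d) : EReal :=
  open Classical in
  if dist q.loc p.loc ≤ q.radius + p.radius then
    ((√((q.radius + p.radius) ^ 2 - dist q.loc p.loc ^ 2) : ℝ) : EReal)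
  else ⊥

/-- A ball of radius zero above `x`, used to read off the height of a set above `x`. -/
def probe {d : ℕ} (x : Space d) : Particle d := (x, 0, 0)

/-- The height at which the centre of the falling ball `p` comes to rest on `A`; it is `-∞` if `p`
misses `A`. -/
def contact {d : ℕ} (A : Set (Space d × ℝ)) (p : Particle d) : EReal :=
  ⨆ c ∈ contactHeights A p, (c : EReal)

/-- Effect on the contact heights `h` of the deposition of the ball `q`. -/
def relax {d : ℕ} (h : Particle d → EReal) (q : Particle d) : Particle d → EReal :=
  fun p => h p ⊔ (h q + link q p)

/-- The supremum of `h p₁ + link p₁ p₂ + ⋯ + link pₖ₋₁ pₖ + g pₖ` over the nonempty sublists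
`p₁, …, pₖ` of a list. -/
def chainSup {d : ℕ} : List (Particle d) → (Particle d → EReal) → (Particle d → EReal) → EReal
  | [], _, _ => ⊥
  | q :: l, h, g => chainSup l (relax h q) g ⊔ (h q + g q)

section EReal

theorem ereal_sup_add (a b c : EReal) : (a ⊔ b) + c = (a + c) ⊔ (b + c) :=
  (Monotone.map_sup (f := fun x : EReal => x + c) (fun _ _ h => add_le_add_left h c) a b)

theorem ereal_add_sup (a b c : EReal) : a + (b ⊔ c) = (a + b) ⊔ (a + c) := by
  rw [add_comm, ereal_sup_add, add_comm b, add_comm c]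

theorem ereal_add_iSup {ι : Sort*} (a : EReal) (f : ι → EReal) :
    a + ⨆ i, f i = ⨆ i, a + f i := by
  refine le_antisymm ?_ (iSup_le fun i => by gcongr; exact le_iSup f i)
  induction a with
  | bot => simp
  | top =>
    by_cases h : ∃ i, f i ≠ ⊥
    · obtain ⟨i, hi⟩ := h
      refine le_trans ?_ (le_iSup _ i)
      rw [EReal.top_add_of_ne_bot hi]
      exact le_top
    · push Not at h
      simp [h]
  | coe a =>
    rw [add_comm]
    refine (EReal.le_sub_iff_add_le (by simp) (by simp)).1 (iSup_le fun i => ?_)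
    refine (EReal.le_sub_iff_add_le (by simp) (by simp)).2 ?_
    rw [add_comm]
    exact le_iSup (fun i => (a : EReal) + f i) i

theorem ereal_iSup_add {ι : Sort*} (f : ι → EReal) (a : EReal) :
    (⨆ i, f i) + a = ⨆ i, f i + a := by
  simp only [add_comm _ a, ereal_add_iSup]

end EReal

section Geometry

variable {d : ℕ}

theorem link_comm (q p : Particle d) : link q p = link p q := by
  unfold link
  rw [dist_comm, add_comm]

theorem mem_solidBall {X : Space d} {c r : ℝ} {y : Space d × ℝ} :
    y ∈ solidBall X c r ↔ dist y.1 X ^ 2 + (y.2 - c) ^ 2 ≤ r ^ 2 := Iff.rfl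

/-- Two balls meet if and only if the distance of the centres is at most the sum of the radii. -/
theorem solidBall_inter_nonempty {X Y : Space d} {b c r s : ℝ} (hr : 0 ≤ r) (hs : 0 ≤ s) :
    (solidBall X b r ∩ solidBall Y c s).Nonempty ↔
      dist X Y ^ 2 + (b - c) ^ 2 ≤ (r + s) ^ 2 := by
  constructor
  · rintro ⟨⟨z, v⟩, h1, h2⟩
    rw [mem_solidBall] at h1 h2
    simp only at h1 h2
    have htri : dist X Y ≤ dist z X + dist z Y := by
      rw [dist_comm z X]; exact dist_triangle _ _ _
    set a1 := dist z X with ha1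
    set a2 := dist z Y with ha2
    have h0 : 0 ≤ dist X Y := dist_nonneg
    have h01 : 0 ≤ a1 := dist_nonneg
    have h02 : 0 ≤ a2 := dist_nonneg
    have hd : dist X Y ^ 2 ≤ (a1 + a2) ^ 2 := by gcongr
    -- the Cauchy--Schwarz inequality in the plane
    have hcs : a1 * a2 - (v - b) * (v - c) ≤ r * s := by
      refine (le_abs_self _).trans (abs_le_of_sq_le_sq ?_ (mul_nonneg hr hs))
      have : (a1 * a2 - (v - b) * (v - c)) ^ 2
          ≤ (a1 ^ 2 + (v - b) ^ 2) * (a2 ^ 2 + (v - c) ^ 2) := by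
        nlinarith [sq_nonneg (a1 * (v - c) + a2 * (v - b))]
      calc _ ≤ (a1 ^ 2 + (v - b) ^ 2) * (a2 ^ 2 + (v - c) ^ 2) := this
        _ ≤ r ^ 2 * s ^ 2 := by gcongr
        _ = (r * s) ^ 2 := by ring
    nlinarith
  · intro h
    rcases (add_nonneg hr hs).eq_or_lt with h0 | h0
    · have hr0 : r = 0 := by linarith
      have hs0 : s = 0 := by linarith
      subst hr0 hs0
      have h1 : dist X Y = 0 := by
        have := sq_nonneg (b - c)
        have : dist X Y ^ 2 ≤ 0 := by nlinarith
        exact pow_eq_zero_iff (two_ne_zero) |>.1 (le_antisymm this (sq_nonneg _))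
      have h2 : b - c = 0 := by
        have : (b - c) ^ 2 ≤ 0 := by nlinarith [sq_nonneg (dist X Y)]
        exact pow_eq_zero_iff (two_ne_zero) |>.1 (le_antisymm this (sq_nonneg _))
      obtain rfl := dist_eq_zero.1 h1
      obtain rfl : b = c := by linarith
      exact ⟨(X, b), by simp [mem_solidBall]⟩
    · -- the point dividing the segment of the centres in the ratio of the radii
      set θ := r / (r + s) with hθ
      have hθ' : 1 - θ = s / (r + s) := by rw [hθ]; field_simp; ring
      refine ⟨(AffineMap.lineMap X Y θ, b + θ * (c - b)), ?_, ?_⟩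
      · rw [mem_solidBall]
        simp only [dist_lineMap_left]
        rw [mul_pow, Real.norm_eq_abs, sq_abs]
        have : θ ^ 2 * (r + s) ^ 2 = r ^ 2 := by rw [hθ]; field_simp
        nlinarith [mul_le_mul_of_nonneg_left h (sq_nonneg θ)]
      · rw [mem_solidBall]
        simp only [dist_lineMap_right]
        rw [mul_pow, Real.norm_eq_abs, sq_abs]
        have : (1 - θ) ^ 2 * (r + s) ^ 2 = s ^ 2 := by rw [hθ']; field_simp
        nlinarith [mul_le_mul_of_nonneg_left h (sq_nonneg (1 - θ))]

theorem contactHeights_union (A B : Set (Space d × ℝ)) (p : Particle d) :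
    contactHeights (A ∪ B) p = contactHeights A p ∪ contactHeights B p := by
  ext c
  simp only [contactHeights, Set.mem_ofPred_eq, Set.inter_union_distrib_left, Set.union_nonempty,
    Set.mem_union]

theorem contact_union (A B : Set (Space d × ℝ)) (p : Particle d) :
    contact (A ∪ B) p = contact A p ⊔ contact B p := by
  simp only [contact, contactHeights_union, iSup_union]

theorem heightAbove_eq_contact (A : Set (Space d × ℝ)) (x : Space d) :
    heightAbove A x = contact A (probe x) := by
  have : {h : ℝ | (x, h) ∈ A} = contactHeights A (probe x) := by
    ext c
    simp only [contactHeights, Set.mem_ofPred_eq, probe, Particle.loc, Particle.radius]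
    constructor
    · intro h
      exact ⟨(x, c), by simp [mem_solidBall], h⟩
    · rintro ⟨⟨y, v⟩, hy, hA⟩
      rw [mem_solidBall] at hy
      simp only at hy
      have h1 : dist y x = 0 := by
        have : dist y x ^ 2 ≤ 0 := by nlinarith [sq_nonneg (v - c)]
        exact pow_eq_zero_iff (two_ne_zero) |>.1 (le_antisymm this (sq_nonneg _))
      have h2 : v - c = 0 := by
        have : (v - c) ^ 2 ≤ 0 := by nlinarith [sq_nonneg (dist y x)]
        exact pow_eq_zero_iff (two_ne_zero) |>.1 (le_antisymm this (sq_nonneg _))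
      obtain rfl := dist_eq_zero.1 h1
      obtain rfl : v = c := by linarith
      exact hA
  rw [heightAbove, contact, this]

theorem bddAbove_contactHeights {A : Set (Space d × ℝ)} (hA : BddAbove (Prod.snd '' A))
    {p : Particle d} (hp : 0 ≤ p.radius) : BddAbove (contactHeights A p) := by
  obtain ⟨M, hM⟩ := hA
  refine ⟨M + p.radius, ?_⟩
  rintro c ⟨⟨y, v⟩, hy, hyA⟩
  rw [mem_solidBall] at hy
  simp only at hy
  have hv : v ≤ M := hM ⟨_, hyA, rfl⟩
  have : |v - c| ≤ p.radius := abs_le_of_sq_le_sq (by nlinarith [sq_nonneg (dist y p.loc)]) hp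
  linarith [neg_abs_le (v - c)]

theorem contact_eq_sSup {A : Set (Space d × ℝ)} (hA : BddAbove (Prod.snd '' A))
    {p : Particle d} (hp : 0 ≤ p.radius) (hne : (contactHeights A p).Nonempty) :
    contact A p = ((sSup (contactHeights A p) : ℝ) : EReal) := by
  have hb := bddAbove_contactHeights hA hp
  refine le_antisymm (iSup₂_le fun c hc => EReal.coe_le_coe_iff.2 (le_csSup hb hc)) ?_
  refine EReal.ge_of_forall_gt_iff_ge.1 fun z hz => ?_
  obtain ⟨c, hc, hzc⟩ := exists_lt_of_lt_csSup hne (EReal.coe_lt_coe_iff.1 hz)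
  exact (EReal.coe_le_coe_iff.2 hzc.le).trans (le_iSup₂ (f := fun (c : ℝ) _ => (c : EReal)) c hc)

theorem contact_eq_bot {A : Set (Space d × ℝ)} {p : Particle d}
    (h : ¬ (contactHeights A p).Nonempty) : contact A p = ⊥ := by
  simp [contact, Set.not_nonempty_iff_eq_empty.1 h]

theorem contact_solidBall {q p : Particle d} (hq : 0 ≤ q.radius) (hp : 0 ≤ p.radius) (c : ℝ) :
    contact (solidBall q.loc c q.radius) p = c + link q p := by
  have hset : contactHeights (solidBall q.loc c q.radius) p =
      {b | dist q.loc p.loc ^ 2 + (b - c) ^ 2 ≤ (q.radius + p.radius) ^ 2} := by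
    ext b
    simp only [contactHeights, Set.mem_ofPred_eq]
    rw [solidBall_inter_nonempty hp hq, dist_comm, add_comm p.radius]
  rw [contact, hset, link]
  split_ifs with h
  · set D := (q.radius + p.radius) ^ 2 - dist q.loc p.loc ^ 2 with hD
    have hD0 : 0 ≤ D := sub_nonneg.2 (by gcongr)
    rw [← EReal.coe_add]
    refine le_antisymm (iSup₂_le fun b hb => EReal.coe_le_coe_iff.2 ?_) ?_
    · have : b - c ≤ √D := Real.le_sqrt_of_sq_le (by rw [hD]; linarith [hb.out])
      linarith
    · refine le_iSup₂ (f := fun (b : ℝ) _ => (b : EReal)) (c + √D) ?_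
      simp only [Set.mem_ofPred_eq, add_sub_cancel_left, Real.sq_sqrt hD0]
      linarith
  · have : {b | dist q.loc p.loc ^ 2 + (b - c) ^ 2 ≤ (q.radius + p.radius) ^ 2} = ∅ := by
      ext b
      simp only [Set.mem_ofPred_eq, Set.mem_empty_iff_false, iff_false, not_le]
      have : (q.radius + p.radius) ^ 2 < dist q.loc p.loc ^ 2 := by
        have := add_nonneg hq hp
        gcongr
        exact not_le.1 h
      nlinarith [sq_nonneg (b - c)]
    simp [this]

/-- In terms of contact heights, a deposition is a max-plus linear operation. -/
theorem contact_deposit {A : Set (Space d × ℝ)} (hA : BddAbove (Prod.snd '' A))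
    {q p : Particle d} (hq : 0 ≤ q.radius) (hp : 0 ≤ p.radius) :
    contact (deposit A q) p = relax (contact A) q p := by
  unfold deposit relax
  split_ifs with h
  · rw [contact_union, contact_solidBall hq hp, ← contact_eq_sSup hA hq h]
  · simp [contact_eq_bot h]

theorem bddAbove_deposit {A : Set (Space d × ℝ)} (hA : BddAbove (Prod.snd '' A))
    {q : Particle d} (hq : 0 ≤ q.radius) : BddAbove (Prod.snd '' deposit A q) := by
  unfold deposit
  split_ifs with h
  · rw [Set.image_union]
    refine hA.union ⟨sSup (contactHeights A q) + q.radius, ?_⟩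
    rintro _ ⟨⟨y, v⟩, hy, rfl⟩
    rw [mem_solidBall] at hy
    simp only at hy ⊢
    have := abs_le_of_sq_le_sq (a := v - sSup (contactHeights A q))
      (by nlinarith [sq_nonneg (dist y q.loc)]) hq
    linarith [le_abs_self (v - sSup (contactHeights A q))]
  · exact hA

/-- The contact heights on an agglomeration follow from those on the initial set by successive
`relax`. The initial contact heights `h` need be known only on a set `G` that contains the deposited
particles: over a flat substrate of finite extent they are simple only for centres above it. -/
theorem contact_agglomeration {l : List (Particle d)} (hl : ∀ q ∈ l, 0 ≤ q.radius)
    {A : Set (Space d × ℝ)} (hA : BddAbove (Prod.snd '' A)) {h : Particle d → EReal}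
    {G : Set (Particle d)} (hlG : ∀ q ∈ l, q ∈ G)
    (hh : ∀ p ∈ G, 0 ≤ p.radius → contact A p = h p) {p : Particle d} (hpG : p ∈ G)
    (hp : 0 ≤ p.radius) :
    contact (agglomeration A l) p = l.foldl relax h p := by
  induction l generalizing A h with
  | nil => exact hh p hpG hp
  | cons q l ih =>
    have hq : 0 ≤ q.radius := hl q (by simp)
    rw [agglomeration, List.foldl_cons, List.foldl_cons]
    refine ih (fun q hq => hl q (by simp [hq])) (bddAbove_deposit hA hq)
      (fun q hq => hlG q (by simp [hq])) fun p hpG hp => ?_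
    rw [contact_deposit hA hq hp, relax, relax, hh p hpG hp, hh q (hlG q (by simp)) hq]

theorem contact_seed {p : Particle d} (hp : 0 ≤ p.radius) :
    contact (seed d) p = link (probe 0) p := by
  have : seed d = solidBall (probe (0 : Space d)).loc 0 (probe (0 : Space d)).radius := by
    ext ⟨y, v⟩
    simp only [seed, probe, Particle.loc, Particle.radius, mem_solidBall, Set.mem_singleton_iff,
      Prod.mk.injEq, sub_zero, ne_eq, OfNat.ofNat_ne_zero, not_false_eq_true, zero_pow]
    constructor
    · rintro ⟨rfl, rfl⟩; simp
    · intro h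
      constructor
      · refine dist_eq_zero.1 (pow_eq_zero_iff (two_ne_zero) |>.1
          (le_antisymm ?_ (sq_nonneg _)))
        nlinarith [sq_nonneg v]
      · refine pow_eq_zero_iff (two_ne_zero) |>.1 (le_antisymm ?_ (sq_nonneg _))
        nlinarith [sq_nonneg (dist y 0)]
  rw [this, contact_solidBall le_rfl hp]
  simp

theorem contact_flat {W : Set (Space d)} {p : Particle d} (hW : p.loc ∈ W) (hp : 0 ≤ p.radius) :
    contact (flat W) p = (p.radius : EReal) := by
  refine le_antisymm (iSup₂_le ?_) (le_iSup₂ (f := fun (c : ℝ) _ => (c : EReal)) p.radius ?_)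
  · rintro c ⟨⟨y, v⟩, hy, hyW⟩
    have hv : v = 0 := hyW.2
    rw [mem_solidBall] at hy
    simp only [hv] at hy
    exact EReal.coe_le_coe_iff.2
      ((le_abs_self _).trans
        (abs_le_of_sq_le_sq (by nlinarith [sq_nonneg (dist y p.loc)]) hp))
  · exact ⟨(p.loc, 0), by simp [mem_solidBall], hW, rfl⟩

theorem bddAbove_seed : BddAbove (Prod.snd '' seed d) := by simp [seed]

theorem bddAbove_flat (W : Set (Space d)) : BddAbove (Prod.snd '' flat W) :=
  ⟨0, by rintro _ ⟨⟨y, v⟩, h, rfl⟩; exact le_of_eq h.2⟩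

end Geometry

section ChainSup

variable {d : ℕ}

theorem relax_sup_add (h g : Particle d → EReal) (q p : Particle d) :
    relax h q p + g p = (h p + g p) ⊔ (h q + link q p + g p) := ereal_sup_add _ _ _

theorem add_relax (h g : Particle d → EReal) (q p : Particle d) :
    h p + relax g q p = (h p + g p) ⊔ (h p + (g q + link q p)) := ereal_add_sup _ _ _

theorem chainSup_concat (l : List (Particle d)) (h g : Particle d → EReal) (p : Particle d) :
    chainSup (l ++ [p]) h g = chainSup l h (relax g p) ⊔ (h p + g p) := by
  induction l generalizing h with
  | nil => simp [chainSup]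
  | cons q l ih =>
    rw [List.cons_append, chainSup, ih, chainSup, relax_sup_add, add_relax]
    have : h q + (g p + link p q) = h q + link q p + g p := by
      rw [link_comm p q, add_assoc, add_comm (g p)]
    rw [this]
    ac_rfl

/-- Reversal of the order of the particles exchanges the roles of the two end weights. This is the
duality of the model. -/
theorem chainSup_reverse (l : List (Particle d)) (h g : Particle d → EReal) :
    chainSup l.reverse h g = chainSup l g h := by
  induction l generalizing h g with
  | nil => rfl
  | cons q l ih => rw [List.reverse_cons, chainSup_concat, ih, chainSup, add_comm]

theorem foldl_relax (l : List (Particle d)) (h : Particle d → EReal) (p : Particle d) :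
    l.foldl relax h p = h p ⊔ chainSup l h (fun q => link q p) := by
  induction l generalizing h with
  | nil => simp [chainSup]
  | cons q l ih =>
    rw [List.foldl_cons, ih, chainSup, relax]
    ac_rfl

theorem chainSup_iSup {ι : Sort*} [Nonempty ι] (l : List (Particle d)) (h : Particle d → EReal)
    (g : ι → Particle d → EReal) :
    chainSup l h (fun q => ⨆ i, g i q) = ⨆ i, chainSup l h (g i) := by
  induction l generalizing h with
  | nil => simp [chainSup]
  | cons q l ih => simp only [chainSup, ih, ereal_add_iSup, iSup_sup_eq]

theorem chainSup_sup (l : List (Particle d)) (h g g' : Particle d → EReal) :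
    chainSup l h (fun q => g q ⊔ g' q) = chainSup l h g ⊔ chainSup l h g' := by
  induction l generalizing h with
  | nil => simp [chainSup]
  | cons q l ih =>
    simp only [chainSup, ih, ereal_add_sup]
    ac_rfl

theorem chainSup_add_const (l : List (Particle d)) (h g : Particle d → EReal) (c : EReal) :
    chainSup l h (fun q => g q + c) = chainSup l h g + c := by
  induction l generalizing h with
  | nil => simp [chainSup]
  | cons q l ih => simp only [chainSup, ih, ereal_sup_add, add_assoc]

theorem chainSup_congr {l : List (Particle d)} {h h' g g' : Particle d → EReal}
    (hh : ∀ q ∈ l, h q = h' q) (hg : ∀ q ∈ l, g q = g' q) :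
    chainSup l h g = chainSup l h' g' := by
  induction l generalizing h h' with
  | nil => rfl
  | cons q l ih =>
    have hq : h q = h' q := hh q (by simp)
    rw [chainSup, chainSup, hq, hg q (by simp),
      ih (h := relax h q) (h' := relax h' q) _ fun q hq => hg q (by simp [hq])]
    intro p hp
    rw [relax, relax, hq, hh p (by simp [hp])]

theorem chainSup_map {f : Particle d → Particle d}
    (hf : ∀ q p, link (f q) (f p) = link q p) (l : List (Particle d))
    (h g : Particle d → EReal) :
    chainSup (l.map f) h g = chainSup l (h ∘ f) (g ∘ f) := by
  induction l generalizing h with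
  | nil => rfl
  | cons q l ih =>
    rw [List.map_cons, chainSup, chainSup, ih]
    congr 2
    ext p
    simp [relax, hf]

theorem link_ne_top (q p : Particle d) : link q p ≠ ⊤ := by
  unfold link
  split_ifs <;> simp

theorem chainSup_ne_top {l : List (Particle d)} {h g : Particle d → EReal}
    (hh : ∀ q, h q ≠ ⊤) (hg : ∀ q, g q ≠ ⊤) : chainSup l h g ≠ ⊤ := by
  induction l generalizing h with
  | nil => simp [chainSup]
  | cons q l ih =>
    have h1 := ih (h := relax h q) fun p =>
      (max_lt (hh p).lt_top (EReal.add_ne_top (hh q) (link_ne_top q p)).lt_top).ne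
    exact (max_lt h1.lt_top (EReal.add_ne_top (hh q) (hg q)).lt_top).ne

theorem iSup_link_probe {q : Particle d} (hq : 0 ≤ q.radius) :
    ⨆ x, link q (probe x) = (q.radius : EReal) := by
  refine le_antisymm (iSup_le fun x => ?_) ?_
  · unfold link
    split_ifs
    · refine EReal.coe_le_coe_iff.2 (Real.sqrt_le_iff.2 ⟨hq, ?_⟩)
      simp only [probe, Particle.radius, add_zero]
      nlinarith [sq_nonneg (dist q.loc (x, (0 : ℝ), (0 : ℝ)).1)]
    · exact bot_le
  · refine le_trans ?_ (le_iSup _ q.loc)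
    have h1 : (probe q.loc).loc = q.loc := rfl
    have h2 : (probe q.loc).radius = 0 := rfl
    simp [link, h1, h2, hq, Real.sqrt_sq hq]

/-- The height at `x` of the deposit grown from the seed. -/
theorem heightAbove_seed {l : List (Particle d)} (hl : ∀ q ∈ l, 0 ≤ q.radius) (x : Space d) :
    heightAbove (agglomeration (seed d) l) x = l.foldl relax (link (probe 0)) (probe x) := by
  rw [heightAbove_eq_contact]
  exact contact_agglomeration hl bddAbove_seed (G := Set.univ) (by simp)
    (fun p _ hp => contact_seed hp) trivial le_rfl

theorem iSup_heightAbove_seed {l : List (Particle d)} (hl : ∀ q ∈ l, 0 ≤ q.radius) :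
    ⨆ x, heightAbove (agglomeration (seed d) l) x =
      0 ⊔ chainSup l (link (probe 0)) (fun q => (q.radius : EReal)) := by
  simp only [heightAbove_seed hl, foldl_relax, iSup_sup_eq, ← chainSup_iSup]
  rw [iSup_link_probe le_rfl]
  congr 1
  exact chainSup_congr (fun _ _ => rfl) fun q hq => iSup_link_probe (hl q hq)

theorem heightAbove_flat {l : List (Particle d)} (hl : ∀ q ∈ l, 0 ≤ q.radius)
    {W : Set (Space d)} (hW : ∀ q ∈ l, q.loc ∈ W) (h0 : 0 ∈ W) :
    heightAbove (agglomeration (flat W) l) 0 =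
      0 ⊔ chainSup l (fun q => (q.radius : EReal)) (link (probe 0)) := by
  rw [heightAbove_eq_contact, contact_agglomeration hl (bddAbove_flat W) (G := {p | p.loc ∈ W})
    hW (fun p hpW hp => contact_flat hpW hp) h0 le_rfl, foldl_relax]
  congr 1
  exact chainSup_congr (fun _ _ => rfl) fun q _ => link_comm _ _

/-- Duality for a fixed list of particles: the flat height at the origin is the maximal height of
the deposit grown from the seed by the same particles in the opposite order. -/
theorem heightAbove_flat_eq_iSup_seed {l : List (Particle d)} (hl : ∀ q ∈ l, 0 ≤ q.radius)
    {W : Set (Space d)} (hW : ∀ q ∈ l, q.loc ∈ W) (h0 : 0 ∈ W) :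
    heightAbove (agglomeration (flat W) l) 0 =
      ⨆ x, heightAbove (agglomeration (seed d) l.reverse) x := by
  rw [heightAbove_flat hl hW h0, iSup_heightAbove_seed (by simpa using hl), chainSup_reverse]

end ChainSup

/-! ### Localisation: the deposit grown from the seed depends on finitely many particles -/

section Arrivals

variable {d : ℕ}

theorem eq_of_pairwise_time_lt {l₁ l₂ : List (Particle d)}
    (h₁ : l₁.Pairwise fun p q => p.time < q.time) (h₂ : l₂.Pairwise fun p q => p.time < q.time)
    (h : ∀ p, p ∈ l₁ ↔ p ∈ l₂) : l₁ = l₂ := by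
  refine List.Perm.eq_of_pairwise (fun a b _ _ hab hba => (lt_asymm hab hba).elim) h₁ h₂ ?_
  refine (List.perm_ext_iff_of_nodup (h₁.imp ?_) (h₂.imp ?_)).2 h <;>
  · rintro a b hab rfl
    exact lt_irrefl _ hab

theorem mem_arrivals {S : Set (Particle d)} (hS : S.Finite) {p : Particle d} :
    p ∈ arrivals S ↔ p ∈ S := by
  rw [arrivals, dif_pos hS, List.mem_insertionSort]
  simp

theorem pairwise_arrivals {S : Set (Particle d)} (hinj : S.InjOn Particle.time) :
    (arrivals S).Pairwise fun p q => p.time < q.time := by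
  by_cases hS : S.Finite
  · have hsorted : (arrivals S).Pairwise fun p q => p.time ≤ q.time := by
      rw [arrivals, dif_pos hS]
      have : Std.Total fun p q : Particle d => p.time ≤ q.time := ⟨fun a b => le_total _ _⟩
      have : IsTrans (Particle d) fun p q => p.time ≤ q.time := ⟨fun a b c => le_trans⟩
      exact List.pairwise_insertionSort _ _
    have hnodup : (arrivals S).Nodup := by
      rw [arrivals, dif_pos hS]
      exact (List.perm_insertionSort _ _).nodup_iff.2 (Finset.nodup_toList _)
    refine (hsorted.and hnodup).imp_of_mem ?_
    rintro p q hp hq ⟨hle, hne⟩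
    exact hle.lt_of_ne fun h => hne (hinj ((mem_arrivals hS).1 hp) ((mem_arrivals hS).1 hq) h)
  · simp [arrivals, hS]

end Arrivals

section Cells

variable {d : ℕ}

/-- The lattice point `z` with `x ∈ z + [0,1)^d`. -/
def cell (x : Space d) : Fin d → ℤ := fun i => ⌊x i⌋

theorem mem_cubes {Q : Finset (Fin d → ℤ)} {x : Space d} : x ∈ cubes Q ↔ cell x ∈ Q := by
  constructor
  · rintro ⟨z, hz, h⟩
    have : cell x = z := funext fun i => Int.floor_eq_iff.2 (h i)
    rwa [this]
  · intro h
    exact ⟨_, h, fun i => ⟨Int.floor_le _, Int.lt_floor_add_one _⟩⟩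

theorem zero_mem_cubes {Q : Finset (Fin d → ℤ)} (h : 0 ∈ Q) : (0 : Space d) ∈ cubes Q := by
  rw [mem_cubes]
  convert h using 1
  ext i
  simp [cell]

end Cells

/-- The particles of `S` that become part of the deposit grown from the seed: those which can be
joined to the origin by a chain of particles of `S` with increasing arrival times in which
neighbours overlap horizontally. -/
inductive Reached {d : ℕ} (S : Set (Particle d)) : Particle d → Prop
  | base {p : Particle d} : p ∈ S → link (probe 0) p ≠ ⊥ → Reached S p
  | step {q p : Particle d} : Reached S q → p ∈ S → q.time < p.time → link q p ≠ ⊥ → Reached S p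

theorem Reached.mem {d : ℕ} {S : Set (Particle d)} {p : Particle d} (h : Reached S p) : p ∈ S := by
  cases h <;> assumption

/-- The properties of a realisation of the process, restricted to the time interval `[0, t]`, that
hold almost surely and on which the pathwise arguments rely. -/
structure IsRegular {d : ℕ} (t : ℝ) (S : Set (Particle d)) : Prop where
  radius_nonneg : ∀ p ∈ S, 0 ≤ p.radius
  time_mem : ∀ p ∈ S, p.time ∈ Set.Icc 0 t
  injOn_time : S.InjOn Particle.time
  finite_inter : ∀ Q : Finset (Fin d → ℤ), (S ∩ {p | p.loc ∈ cubes Q}).Finite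
  finite_reached : {p | Reached S p}.Finite

section Localisation

variable {d : ℕ} {t : ℝ} {S : Set (Particle d)}

theorem IsRegular.restriction_eq (hS : IsRegular t S) (W : Set (Space d)) :
    restriction S W t = S ∩ {p | p.loc ∈ W} := by
  ext p
  constructor
  · rintro ⟨h1, h2, -⟩
    exact ⟨h1, h2⟩
  · rintro ⟨h1, h2⟩
    exact ⟨h1, h2, hS.time_mem p h1⟩

theorem IsRegular.finite_restriction (hS : IsRegular t S) (Q : Finset (Fin d → ℤ)) :
    (restriction S (cubes Q) t).Finite := by
  rw [hS.restriction_eq]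
  exact hS.finite_inter Q

theorem IsRegular.injOn_restriction (hS : IsRegular t S) (W : Set (Space d)) :
    (restriction S W t).InjOn Particle.time :=
  hS.injOn_time.mono fun _ h => h.1

theorem foldl_relax_ne_bot {l : List (Particle d)} {h : Particle d → EReal} {p : Particle d}
    (hp : l.foldl relax h p ≠ ⊥) : h p ≠ ⊥ ∨ ∃ q ∈ l, link q p ≠ ⊥ := by
  induction l generalizing h with
  | nil => exact Or.inl hp
  | cons q l ih =>
    rcases ih hp with h1 | ⟨q', hq', h1⟩
    · by_contra! hcon
      refine h1 ?_
      rw [relax, hcon.1, hcon.2 q (by simp)]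
      simp
    · exact Or.inr ⟨q', by simp [hq'], h1⟩

open Classical in
/-- Only the reached particles influence the deposit grown from the seed. -/
theorem foldl_relax_filter_reached {l : List (Particle d)}
    (hl : l.Pairwise fun p q => p.time < q.time) (hlS : ∀ p ∈ l, p ∈ S) :
    l.foldl relax (link (probe 0)) =
      (l.filter fun p => Reached S p).foldl relax (link (probe 0)) := by
  induction l using List.reverseRecOn with
  | nil => rfl
  | append_singleton l p ih =>
    rw [List.pairwise_append] at hl
    have ih := ih hl.1 fun q hq => hlS q (by simp [hq])
    rw [List.filter_append, List.foldl_append, List.foldl_append, ih]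
    by_cases hp : Reached S p
    · simp [hp]
    · simp only [hp, List.foldl_cons, List.foldl_nil, decide_false, Bool.false_eq_true,
        not_false_eq_true, List.filter_cons_of_neg, List.filter_nil]
      have hbot : (l.filter fun p => Reached S p).foldl relax (link (probe 0)) p = ⊥ := by
        by_contra hne
        refine hp ?_
        rcases foldl_relax_ne_bot hne with h | ⟨q, hq, h⟩
        · exact .base (hlS p (by simp)) h
        · rw [List.mem_filter] at hq
          exact .step (by simpa using hq.2) (hlS p (by simp)) (hl.2.2 q hq.1 p (by simp)) h
      ext p'
      rw [relax, hbot]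
      simp

/-- Since all reached particles lie over `cubes (Q n)` for large `n`, the seed heights are eventually
constant in `n`, uniformly in the position. -/
theorem IsRegular.eventually_seedHeight (hS : IsRegular t S) {Q : ℕ → Finset (Fin d → ℤ)}
    (hQ : ∀ z : Fin d → ℤ, ∀ᶠ n in atTop, z ∈ Q n) :
    ∀ᶠ n in atTop, ∀ x, seedHeight Q S t n x =
      (arrivals {p | Reached S p}).foldl relax (link (probe 0)) (probe x) := by
  have hev : ∀ᶠ n in atTop, ∀ p ∈ {p | Reached S p}, p.loc ∈ cubes (Q n) :=
    (Set.Finite.eventually_all hS.finite_reached).2 fun p _ => by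
      simpa only [mem_cubes] using hQ (cell p.loc)
  classical
  filter_upwards [hev] with n hn x
  have hfin := hS.finite_restriction (Q n)
  have hpw := pairwise_arrivals (hS.injOn_restriction (cubes (Q n)))
  rw [seedHeight, heightAbove_seed, foldl_relax_filter_reached (S := S) hpw]
  · refine congrArg (fun l => List.foldl relax (link (probe 0)) l (probe x)) ?_
    refine eq_of_pairwise_time_lt (hpw.filter _)
      (pairwise_arrivals (hS.injOn_time.mono fun p hp => Reached.mem hp)) fun p => ?_
    rw [mem_arrivals hS.finite_reached, List.mem_filter, mem_arrivals hfin]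
    constructor
    · rintro ⟨-, h⟩
      simpa using h
    · intro h
      refine ⟨?_, by simpa using h⟩
      rw [hS.restriction_eq]
      exact ⟨Reached.mem h, hn p h⟩
  · intro p hp
    exact ((mem_arrivals hfin).1 hp).1
  · intro p hp
    exact hS.radius_nonneg p ((mem_arrivals hfin).1 hp).1

theorem IsRegular.eventually_seedHeight_eq (hS : IsRegular t S) {Q : ℕ → Finset (Fin d → ℤ)}
    (hQ : ∀ z : Fin d → ℤ, ∀ᶠ n in atTop, z ∈ Q n) :
    ∀ᶠ n in atTop, ∀ x, seedHeight Q S t n x = infiniteSeedHeight Q S t x := by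
  have h := hS.eventually_seedHeight hQ
  filter_upwards [h] with n hn x
  rw [hn, infiniteSeedHeight, limsup_congr (h.mono fun n hn => hn x), limsup_const]

theorem IsRegular.tendsto_seedHeight (hS : IsRegular t S) {Q : ℕ → Finset (Fin d → ℤ)}
    (hQ : ∀ z : Fin d → ℤ, ∀ᶠ n in atTop, z ∈ Q n) (x : Space d) :
    Tendsto (fun n => seedHeight Q S t n x) atTop (𝓝 (infiniteSeedHeight Q S t x)) :=
  tendsto_const_nhds.congr' ((hS.eventually_seedHeight_eq hQ).mono fun _ hn => (hn x).symm)

theorem IsRegular.eventually_iSup_seedHeight (hS : IsRegular t S) {Q : ℕ → Finset (Fin d → ℤ)}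
    (hQ : ∀ z : Fin d → ℤ, ∀ᶠ n in atTop, z ∈ Q n) :
    ∀ᶠ n in atTop, ⨆ x, seedHeight Q S t n x = seedDepth Q S t :=
  (hS.eventually_seedHeight_eq hQ).mono fun _ hn => iSup_congr hn

theorem IsRegular.iSup_seedHeight (hS : IsRegular t S) (Q : ℕ → Finset (Fin d → ℤ)) (n : ℕ) :
    ⨆ x, seedHeight Q S t n x =
      0 ⊔ chainSup (arrivals (S ∩ {p | p.loc ∈ cubes (Q n)})) (link (probe 0))
        (fun q => (q.radius : EReal)) := by
  rw [← hS.restriction_eq, ← iSup_heightAbove_seed]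
  · rfl
  · intro p hp
    exact hS.radius_nonneg p ((mem_arrivals (hS.finite_restriction _)).1 hp).1

/-- The maximal height of the deposit grown from the seed is a real number. -/
theorem IsRegular.exists_seedDepth_eq (hS : IsRegular t S) {Q : ℕ → Finset (Fin d → ℤ)}
    (hQ : ∀ z : Fin d → ℤ, ∀ᶠ n in atTop, z ∈ Q n) : ∃ h : ℝ, seedDepth Q S t = h := by
  obtain ⟨n, hn⟩ := (hS.eventually_iSup_seedHeight hQ).exists
  rw [← hn, hS.iSup_seedHeight]
  refine ⟨_, (EReal.coe_toReal ?_ ?_).symm⟩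
  · exact (max_lt EReal.zero_lt_top (chainSup_ne_top (fun q => link_ne_top _ _)
      fun q => EReal.coe_ne_top _).lt_top).ne
  · exact (lt_of_lt_of_le EReal.bot_lt_zero le_sup_left).ne'

end Localisation

section Reflection

variable {d : ℕ} {t : ℝ} {S : Set (Particle d)}

/-- Reversal of the time interval `[0, t]`. -/
def reflect (t : ℝ) (p : Particle d) : Particle d := (p.1, t - p.2.1, p.2.2)

theorem reflect_reflect (t : ℝ) (p : Particle d) : reflect t (reflect t p) = p := by
  simp [reflect]

theorem time_reflect (t : ℝ) (p : Particle d) : (reflect t p).time = t - p.time := rfl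

theorem link_reflect (t : ℝ) (q p : Particle d) : link (reflect t q) (reflect t p) = link q p := rfl

/-- The flat height at the origin is the maximal height of the deposit grown from the seed by the
particles with reversed arrival times. -/
theorem IsRegular.flatHeight_eq (hS : IsRegular t S) {Q : ℕ → Finset (Fin d → ℤ)} {n : ℕ}
    (h0 : 0 ∈ Q n) (hS' : IsRegular t (reflect t ⁻¹' S)) :
    flatHeight Q S t n 0 = ⨆ x, seedHeight Q (reflect t ⁻¹' S) t n x := by
  have hfin := hS.finite_restriction (Q n)
  have hfin' := hS'.finite_restriction (Q n)
  have harr : arrivals (restriction (reflect t ⁻¹' S) (cubes (Q n)) t) =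
      ((arrivals (restriction S (cubes (Q n)) t)).map (reflect t)).reverse := by
    refine eq_of_pairwise_time_lt (pairwise_arrivals (hS'.injOn_restriction _)) ?_ fun p => ?_
    · rw [List.pairwise_reverse, List.pairwise_map]
      refine (pairwise_arrivals (hS.injOn_restriction _)).imp fun h => ?_
      rw [time_reflect, time_reflect]
      linarith
    · rw [mem_arrivals hfin', List.mem_reverse, List.mem_map, hS'.restriction_eq]
      simp only [mem_arrivals hfin]
      rw [hS.restriction_eq]
      constructor
      · rintro ⟨h1, h2⟩
        exact ⟨reflect t p, ⟨h1, h2⟩, reflect_reflect t p⟩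
      · rintro ⟨q, ⟨h1, h2⟩, rfl⟩
        refine ⟨?_, h2⟩
        rwa [Set.mem_preimage, reflect_reflect]
  rw [hS'.iSup_seedHeight, ← hS'.restriction_eq, harr, chainSup_reverse,
    chainSup_map (link_reflect t), flatHeight, heightAbove_flat]
  · rfl
  · intro p hp
    exact hS.radius_nonneg p ((mem_arrivals hfin).1 hp).1
  · intro p hp
    exact ((mem_arrivals hfin).1 hp).2.1
  · exact zero_mem_cubes h0

end Reflection

/-! ### Measurability of the maximal height in the point configuration -/

section ChainStep

variable {d : ℕ}

/-- The supremum of `h p₁ + link p₁ p₂ + ⋯ + link pⱼ p` over the chains `p₁, …, pⱼ` of at most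
`k` particles of `T` with increasing arrival times that precede `p`; the empty chain contributes `h p`.
-/
def chainStep (T : Set (Particle d)) (h : Particle d → EReal) : ℕ → Particle d → EReal
  | 0, p => h p
  | k + 1, p => h p ⊔ ⨆ q ∈ T, ⨆ _ : q.time < p.time, (chainStep T h k q + link q p)

/-- An expression for `chainSup` that refers to the set of particles instead of its ordered list. -/
def chainDepth (T : Set (Particle d)) (h g : Particle d → EReal) : EReal :=
  ⨆ k, ⨆ q ∈ T, (chainStep T h k q + g q)

theorem chainStep_congr {T T' : Set (Particle d)} {s : ℝ}
    (hT : ∀ q, q.time < s → (q ∈ T ↔ q ∈ T')) (h : Particle d → EReal) (k : ℕ) {p : Particle d}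
    (hp : p.time ≤ s) : chainStep T h k p = chainStep T' h k p := by
  induction k generalizing p with
  | zero => rfl
  | succ k ih =>
    have key : ∀ {U U' : Set (Particle d)}, (∀ q, q.time < s → (q ∈ U → q ∈ U')) →
        (∀ {q : Particle d}, q.time ≤ s → chainStep U h k q = chainStep U' h k q) →
        chainStep U h (k + 1) p ≤ chainStep U' h (k + 1) p := by
      intro U U' hU hUU'
      refine sup_le_sup le_rfl (iSup₂_le fun q hq => iSup_le fun hqp => ?_)
      have hqs := hqp.trans_le hp
      rw [hUU' hqs.le]
      exact le_iSup₂_of_le q (hU q hqs hq) (le_iSup_of_le hqp le_rfl)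
    exact le_antisymm (key (fun q hq => (hT q hq).1) ih)
      (key (fun q hq => (hT q hq).2) fun hq => (ih hq).symm)

theorem chainDepth_eq_chainSup {l : List (Particle d)}
    (hl : l.Pairwise fun p q => p.time < q.time) (h g : Particle d → EReal) :
    chainDepth {q | q ∈ l} h g = chainSup l h g := by
  induction l using List.reverseRecOn generalizing g with
  | nil => simp [chainDepth, chainSup]
  | append_singleton l p ih =>
    rw [List.pairwise_append] at hl
    have hlt : ∀ q ∈ l, q.time < p.time := fun q hq => hl.2.2 q hq p (by simp)
    have hcongr : ∀ k {q : Particle d}, q.time ≤ p.time →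
        chainStep {q | q ∈ l ++ [p]} h k q = chainStep {q | q ∈ l} h k q := by
      intro k q hq
      refine chainStep_congr (s := p.time) (fun q' hq' => ?_) h k hq
      simp only [List.mem_append, List.mem_singleton, Set.mem_ofPred_eq, or_iff_left_iff_imp]
      rintro rfl
      exact (lt_irrefl _ hq').elim
    have hlast : ⨆ k, chainStep {q | q ∈ l ++ [p]} h k p =
        h p ⊔ chainSup l h fun q => link q p := by
      rw [← ih hl.1, ← sup_iSup_nat_succ]
      simp only [hcongr _ le_rfl]
      simp only [chainStep, ← sup_iSup, chainDepth]
      rw [← sup_assoc, sup_idem]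
      congr 1
      refine iSup_congr fun k => iSup_congr fun q => iSup_congr fun hq => ?_
      simp [hlt q hq]
    have hsplit : chainDepth {q | q ∈ l ++ [p]} h g =
        chainDepth {q | q ∈ l} h g ⊔ ((⨆ k, chainStep {q | q ∈ l ++ [p]} h k p) + g p) := by
      rw [ereal_iSup_add, chainDepth, chainDepth, ← iSup_sup_eq]
      refine iSup_congr fun k => ?_
      simp only [List.mem_append, List.mem_singleton, Set.mem_ofPred_eq, iSup_or, iSup_sup_eq,
        iSup_iSup_eq_left]
      congr 1
      refine iSup_congr fun q => iSup_congr fun hq => ?_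
      rw [← hcongr k (hlt q hq).le]
      simp
    rw [hsplit, hlast, ih hl.1, chainSup_concat]
    have hrelax : chainSup l h (relax g p) =
        chainSup l h g ⊔ (chainSup l h (fun q => link q p) + g p) := by
      rw [← chainSup_add_const, ← chainSup_sup]
      refine chainSup_congr (fun _ _ => rfl) fun q _ => ?_
      rw [relax, link_comm, add_comm (g p)]
    rw [hrelax, ereal_sup_add]
    ac_rfl

theorem measurable_link : Measurable fun x : Particle d × Particle d => link x.1 x.2 := by
  unfold link Particle.loc Particle.radius
  refine Measurable.ite ?_ ?_ measurable_const
  · exact measurableSet_le (by fun_prop) (by fun_prop)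
  · exact measurable_coe_real_ereal.comp (by fun_prop)

theorem measurable_time : Measurable (Particle.time : Particle d → ℝ) := by
  unfold Particle.time
  fun_prop

end ChainStep

/-- The space of point configurations in `α`. -/
structure Config (α : Type*) where
  /-- The set of points of the configuration. -/
  points : Set α

namespace Config

variable {α : Type*}

open Classical in
/-- The points of a configuration in `B` if there are finitely many of them, otherwise the empty
set. -/
def finitePart (B : Set α) (S : Config α) : Set α :=
  if (S.points ∩ B).Finite then S.points ∩ B else ∅

theorem mem_finitePart {B : Set α} {S : Config α} {q : α} :
    q ∈ finitePart B S ↔ (S.points ∩ B).Finite ∧ q ∈ S.points ∩ B := by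
  unfold finitePart
  split_ifs with h <;> simp [h]

variable [MeasurableSpace α]

/-- The number of points of a configuration in each measurable set. -/
def counts (S : Config α) (B : {B : Set α // MeasurableSet B}) : ℕ∞ :=
  Set.encard (S.points ∩ B)

/-- The σ-algebra generated by the numbers of points in measurable sets. -/
instance : MeasurableSpace (Config α) := MeasurableSpace.comap counts inferInstance

theorem measurable_counts : Measurable (counts : Config α → _) := comap_measurable _

theorem measurable_encard {B : Set α} (hB : MeasurableSet B) :
    Measurable fun S : Config α => Set.encard (S.points ∩ B) :=
  (measurable_pi_apply (⟨B, hB⟩ : {B : Set α // MeasurableSet B})).comp measurable_counts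

variable [MeasurableSingletonClass α]

open Classical in
/-- The counting measure of the points in `B`, if their number is `j`, otherwise zero. -/
def countKernel {B : Set α} (hB : MeasurableSet B) (j : ℕ) : Kernel (Config α) α where
  toFun S := if Set.encard (S.points ∩ B) = j then
    Measure.count.restrict (S.points ∩ B) else 0
  measurable' := by
    refine Measure.measurable_of_measurable_coe _ fun s hs => ?_
    have : (fun S : Config α => (if Set.encard (S.points ∩ B) = j then
        Measure.count.restrict (S.points ∩ B) else 0) s) =
        fun S : Config α => if Set.encard (S.points ∩ B) = j then
          ((Set.encard (S.points ∩ (B ∩ s)) : ℕ∞) : ℝ≥0∞) else 0 := by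
      ext S
      split_ifs with h
      · have hfin : (S.points ∩ B).Finite :=
          Set.finite_of_encard_le_coe h.le
        rw [Measure.restrict_apply hs, Measure.count_apply (hs.inter hfin.measurableSet),
          Set.inter_comm s, Set.inter_assoc]
      · rfl
    rw [this]
    refine Measurable.ite (measurable_encard hB (measurableSet_singleton _)) ?_ measurable_const
    exact (Measurable.of_discrete (f := fun m : ℕ∞ => (m : ℝ≥0∞))).comp
      (measurable_encard (hB.inter hs))

theorem countKernel_apply {B : Set α} (hB : MeasurableSet B) {j : ℕ} {S : Config α}
    (h : Set.encard (S.points ∩ B) = j) {s : Set α} (hs : MeasurableSet s) :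
    countKernel hB j S s = (Set.encard (s ∩ (S.points ∩ B)) : ℕ∞) := by
  have hfin : (S.points ∩ B).Finite := Set.finite_of_encard_le_coe h.le
  rw [countKernel, Kernel.coe_mk, if_pos h, Measure.restrict_apply hs,
    Measure.count_apply (hs.inter hfin.measurableSet)]

instance {B : Set α} (hB : MeasurableSet B) (j : ℕ) : IsFiniteKernel (countKernel hB j) := by
  refine ⟨⟨j, by simp, fun S => ?_⟩⟩
  by_cases h : Set.encard (S.points ∩ B) = j
  · rw [countKernel_apply hB h .univ, Set.univ_inter, h]
    simp
  · rw [countKernel, Kernel.coe_mk, if_neg h]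
    simp

/-- The existence of a point of the configuration with a given property is a measurable event,
jointly in the configuration and a parameter on which the property depends. -/
theorem measurableSet_exists_mem_finitePart {β : Type*} [MeasurableSpace β] {B : Set α}
    (hB : MeasurableSet B) {C : Set ((Config α × β) × α)} (hC : MeasurableSet C) :
    MeasurableSet {x : Config α × β | ∃ q ∈ finitePart B x.1, (x, q) ∈ C} := by
  have : {x : Config α × β | ∃ q ∈ finitePart B x.1, (x, q) ∈ C} =
      ⋃ j : ℕ, {x | Set.encard (x.1.points ∩ B) = j} ∩
        {x | ((countKernel hB j).comap Prod.fst measurable_fst : Kernel (Config α × β) α) x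
          (Prod.mk x ⁻¹' C) ≠ 0} := by
    ext x
    simp only [mem_finitePart, Set.mem_ofPred_eq, Set.mem_iUnion, Set.mem_inter_iff]
    constructor
    · rintro ⟨q, ⟨hfin, hq⟩, hqC⟩
      refine ⟨hfin.toFinset.card, hfin.encard_eq_coe_toFinset_card, ?_⟩
      rw [Kernel.comap_apply, countKernel_apply hB hfin.encard_eq_coe_toFinset_card
        (measurable_prodMk_left hC)]
      simp only [ne_eq, ENat.toENNReal_eq_zero, Set.encard_eq_zero]
      exact Set.Nonempty.ne_empty ⟨q, hqC, hq⟩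
    · rintro ⟨j, hj, hne⟩
      rw [Kernel.comap_apply, countKernel_apply hB hj (measurable_prodMk_left hC)] at hne
      simp only [ne_eq, ENat.toENNReal_eq_zero, Set.encard_eq_zero] at hne
      obtain ⟨q, hqC, hq⟩ := Set.nonempty_iff_ne_empty.2 hne
      exact ⟨q, ⟨Set.finite_of_encard_le_coe hj.le, hq⟩, hqC⟩
  rw [this]
  refine MeasurableSet.iUnion fun j => MeasurableSet.inter ?_ ?_
  · exact ((measurable_encard hB).comp measurable_fst) (measurableSet_singleton _)
  · exact (Kernel.measurable_kernel_prodMk_left hC) (measurableSet_singleton 0).compl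

theorem measurable_iSup_finitePart {β : Type*} [MeasurableSpace β] {B : Set α}
    (hB : MeasurableSet B) {f : Config α × β → α → EReal}
    (hf : Measurable fun x : (Config α × β) × α => f x.1 x.2) :
    Measurable fun x : Config α × β => ⨆ q ∈ finitePart B x.1, f x q := by
  refine measurable_of_Ioi fun a => ?_
  convert measurableSet_exists_mem_finitePart hB (hf (measurableSet_Ioi (a := a))) using 1
  ext x
  simp [lt_iSup_iff]

end Config

section MeasurableDepth

variable {d : ℕ}

theorem measurable_iSup_add_link {B : Set (Particle d)} (hB : MeasurableSet B)
    {f : Config (Particle d) × Particle d → EReal} (hf : Measurable f) :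
    Measurable fun x : Config (Particle d) × Particle d =>
      ⨆ q ∈ Config.finitePart B x.1, ⨆ _ : q.time < x.2.time, (f (x.1, q) + link q x.2) := by
  refine Config.measurable_iSup_finitePart hB
    (f := fun x q => ⨆ _ : q.time < x.2.time, (f (x.1, q) + link q x.2)) ?_
  classical
  simp only [iSup_eq_if]
  refine Measurable.ite ?_ ?_ measurable_const
  · exact measurableSet_lt (measurable_time.comp measurable_snd)
      (measurable_time.comp (measurable_snd.comp measurable_fst))
  · have h₁ : Measurable fun x : (Config (Particle d) × Particle d) × Particle d =>
        (x.1.1, x.2) := by fun_prop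
    have h₂ : Measurable fun x : (Config (Particle d) × Particle d) × Particle d =>
        (x.2, x.1.2) := by fun_prop
    have h₃ := hf.comp h₁
    have h₄ := measurable_link.comp h₂
    exact h₃.fun_add h₄

theorem measurable_iSup_add {B : Set (Particle d)} (hB : MeasurableSet B)
    {f : Config (Particle d) × Particle d → EReal} (hf : Measurable f)
    {g : Particle d → EReal} (hg : Measurable g) :
    Measurable fun S : Config (Particle d) => ⨆ q ∈ Config.finitePart B S, (f (S, q) + g q) := by
  have h₁ : Measurable fun x : (Config (Particle d) × Unit) × Particle d => (x.1.1, x.2) := by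
    fun_prop
  have h₂ : Measurable fun x : (Config (Particle d) × Unit) × Particle d =>
      f (x.1.1, x.2) + g x.2 := by
    have h₅ := hf.comp h₁
    have h₆ : Measurable fun x : (Config (Particle d) × Unit) × Particle d => g x.2 :=
      hg.comp measurable_snd
    exact h₅.fun_add h₆
  have h₃ : Measurable fun S : Config (Particle d) => (S, ()) := by fun_prop
  have h₄ := Config.measurable_iSup_finitePart (f := fun x q => f (x.1, q) + g q) hB h₂
  have h₇ := h₄.comp h₃
  exact h₇

theorem measurable_chainStep {B : Set (Particle d)} (hB : MeasurableSet B)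
    {h : Particle d → EReal} (hh : Measurable h) (k : ℕ) :
    Measurable fun x : Config (Particle d) × Particle d =>
      chainStep (Config.finitePart B x.1) h k x.2 := by
  induction k with
  | zero => exact hh.comp measurable_snd
  | succ k ih =>
    have h₁ : Measurable fun x : Config (Particle d) × Particle d => h x.2 :=
      hh.comp measurable_snd
    have h₂ := measurable_iSup_add_link hB ih
    exact h₁.max h₂

theorem measurable_chainDepth {B : Set (Particle d)} (hB : MeasurableSet B)
    {h g : Particle d → EReal} (hh : Measurable h) (hg : Measurable g) :
    Measurable fun S : Config (Particle d) => chainDepth (Config.finitePart B S) h g :=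
  Measurable.iSup fun k => measurable_iSup_add hB (measurable_chainStep hB hh k) hg

theorem measurableSet_cubes (Q : Finset (Fin d → ℤ)) : MeasurableSet (cubes Q) := by
  have : cubes Q = ⋃ z ∈ Q, ⋂ i, {x : Space d | (z i : ℝ) ≤ x i ∧ x i < z i + 1} := by
    ext x
    simp [cubes]
  rw [this]
  refine Finset.measurableSet_biUnion _ fun z _ => MeasurableSet.iInter fun i => ?_
  have hi : Measurable fun x : Space d => x i := by fun_prop
  exact (measurableSet_le measurable_const hi).inter (measurableSet_lt hi measurable_const)

/-- A measurable function of the configuration that agrees with `seedDepth` on regular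
configurations. -/
def measurableDepth (Q : ℕ → Finset (Fin d → ℤ)) (S : Config (Particle d)) : EReal :=
  limsup (fun n => 0 ⊔ chainDepth (Config.finitePart {p | p.loc ∈ cubes (Q n)} S)
    (link (probe 0)) (fun q => (q.radius : EReal))) atTop

theorem measurable_loc : Measurable (Particle.loc : Particle d → Space d) := measurable_fst

theorem measurable_radius : Measurable (Particle.radius : Particle d → ℝ) := measurable_snd.snd

theorem measurable_measurableDepth (Q : ℕ → Finset (Fin d → ℤ)) :
    Measurable (measurableDepth Q) := by
  refine Measurable.limsup fun n => measurable_const.max (measurable_chainDepth ?_ ?_ ?_)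
  · exact measurable_loc (measurableSet_cubes _)
  · have h₁ : Measurable fun p : Particle d => (probe (0 : Space d), p) := by fun_prop
    have h₂ := measurable_link.comp h₁
    exact h₂
  · exact measurable_coe_real_ereal.comp measurable_radius

theorem IsRegular.seedDepth_eq {t : ℝ} {S : Set (Particle d)} (hS : IsRegular t S)
    {Q : ℕ → Finset (Fin d → ℤ)} (hQ : ∀ z : Fin d → ℤ, ∀ᶠ n in atTop, z ∈ Q n) :
    seedDepth Q S t = measurableDepth Q ⟨S⟩ := by
  have h : ∀ n, chainDepth (Config.finitePart {p | p.loc ∈ cubes (Q n)} ⟨S⟩) (link (probe 0))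
      (fun q => (q.radius : EReal)) = chainSup (arrivals (S ∩ {p | p.loc ∈ cubes (Q n)}))
      (link (probe 0)) (fun q => (q.radius : EReal)) := by
    intro n
    rw [← chainDepth_eq_chainSup
      (pairwise_arrivals (hS.injOn_time.mono Set.inter_subset_left))]
    congr 1
    ext q
    rw [Config.mem_finitePart, Set.mem_ofPred_eq, mem_arrivals (hS.finite_inter (Q n))]
    exact and_iff_right (hS.finite_inter (Q n))
  simp only [measurableDepth, h, ← hS.iSup_seedHeight]
  rw [limsup_congr (hS.eventually_iSup_seedHeight hQ), limsup_const]

end MeasurableDepth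

/-! ### Poisson processes: uniqueness in law, restriction, time reversal -/

namespace IsPoissonProcess

variable {α Ω Ω' : Type*} [MeasurableSpace α] [MeasurableSpace Ω] [MeasurableSpace Ω']
  {μ : Measure Ω} {ν : Measure Ω'} {Λ : Measure α} {P : Ω → Set α} {P' : Ω' → Set α}

theorem measurable_config (hP : IsPoissonProcess μ Λ P) :
    Measurable fun ω => (⟨P ω⟩ : Config α) := by
  rw [measurable_comap_iff]
  exact measurable_pi_lambda _ fun B => hP.measurable_count B.1 B.2

theorem map_count_eq [IsProbabilityMeasure μ] [IsProbabilityMeasure ν]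
    (hP : IsPoissonProcess μ Λ P) (hP' : IsPoissonProcess ν Λ P') {B : Set α}
    (hB : MeasurableSet B) :
    μ.map (fun ω => (P ω ∩ B).encard) = ν.map fun ω => (P' ω ∩ B).encard := by
  by_cases h : Λ B = ∞
  · rw [Measure.map_congr (hP.count_top B hB h), Measure.map_congr (hP'.count_top B hB h)]
    simp
  · rw [hP.count_law B hB h, hP'.count_law B hB h]

/-- The joint law of the numbers of points in finitely many sets, which need not be disjoint. It is
reduced to the disjoint case by passage to the atoms of the algebra that these sets generate. -/
theorem map_counts_eq [IsProbabilityMeasure μ] [IsProbabilityMeasure ν]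
    (hP : IsPoissonProcess μ Λ P) (hP' : IsPoissonProcess ν Λ P') {ι : Type*} [Fintype ι]
    {B : ι → Set α} (hB : ∀ j, MeasurableSet (B j)) :
    μ.map (fun ω j => (P ω ∩ B j).encard) = ν.map fun ω j => (P' ω ∩ B j).encard := by
  classical
  let e : Fin (Fintype.card (ι → Bool)) ≃ (ι → Bool) := (Fintype.equivFin _).symm
  let A : (ι → Bool) → Set α := fun s => {x | ∀ j, x ∈ B j ↔ s j = true}
  have hA : ∀ s, MeasurableSet (A s) := by
    intro s
    have : A s = ⋂ j, if s j then B j else (B j)ᶜ := by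
      ext x
      simp only [A, Set.mem_ofPred_eq, Set.mem_iInter]
      refine forall_congr' fun j => ?_
      cases s j <;> simp
    rw [this]
    refine MeasurableSet.iInter fun j => ?_
    split_ifs
    · exact hB j
    · exact (hB j).compl
  have hdisj : Pairwise fun i j => Disjoint (A (e i)) (A (e j)) := by
    intro i j hij
    refine Set.disjoint_left.2 fun x hxi hxj => hij (e.injective (funext fun k => ?_))
    rw [Bool.eq_iff_iff]
    exact (hxi k).symm.trans (hxj k)
  let Ψ : (Fin (Fintype.card (ι → Bool)) → ℕ∞) → ι → ℕ∞ :=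
    fun c j => ∑ i, if e i j then c i else 0
  have hΨ : Measurable Ψ := by
    refine measurable_pi_lambda _ fun j => Finset.measurable_fun_sum _ fun i _ => ?_
    split_ifs
    · exact measurable_pi_apply i
    · exact measurable_const
  have key : ∀ S : Set α, (fun j => (S ∩ B j).encard) = Ψ fun i => (S ∩ A (e i)).encard := by
    intro S
    ext1 j
    have hU : S ∩ B j = ⋃ i, S ∩ (B j ∩ A (e i)) := by
      rw [← Set.inter_iUnion, ← Set.inter_iUnion]
      have : ⋃ i, A (e i) = Set.univ := by
        refine Set.eq_univ_of_forall fun x => Set.mem_iUnion.2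
          ⟨e.symm fun j => decide (x ∈ B j), ?_⟩
        simp [A]
      rw [this, Set.inter_univ]
    rw [hU, Set.encard_iUnion_of_finite, finsum_eq_sum_of_fintype]
    · refine Finset.sum_congr rfl fun i _ => ?_
      split_ifs with h
      · congr 2
        exact Set.inter_eq_right.2 fun x hx => (hx j).2 h
      · rw [Set.encard_eq_zero]
        refine Set.eq_empty_of_forall_notMem fun x hx => h ((hx.2.2 j).1 hx.2.1)
    · intro i i' hii'
      exact ((hdisj hii').mono Set.inter_subset_right Set.inter_subset_right).mono
        Set.inter_subset_right Set.inter_subset_right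
  have hm : Measurable fun ω i => (P ω ∩ A (e i)).encard :=
    measurable_pi_lambda _ fun i => hP.measurable_count _ (hA _)
  have hm' : Measurable fun ω i => (P' ω ∩ A (e i)).encard :=
    measurable_pi_lambda _ fun i => hP'.measurable_count _ (hA _)
  have hlaw : μ.map (fun ω i => (P ω ∩ A (e i)).encard) =
      ν.map fun ω i => (P' ω ∩ A (e i)).encard := by
    rw [(hP.indep _ _ (fun i => hA (e i)) hdisj).map_fun_eq_pi_map
        fun i => (hP.measurable_count _ (hA _)).aemeasurable,
      (hP'.indep _ _ (fun i => hA (e i)) hdisj).map_fun_eq_pi_map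
        fun i => (hP'.measurable_count _ (hA _)).aemeasurable]
    congr 1
    ext1 i
    exact hP.map_count_eq hP' (hA _)
  have hk : (fun ω j => (P ω ∩ B j).encard) = Ψ ∘ fun ω i => (P ω ∩ A (e i)).encard :=
    funext fun ω => key (P ω)
  have hk' : (fun ω j => (P' ω ∩ B j).encard) = Ψ ∘ fun ω i => (P' ω ∩ A (e i)).encard :=
    funext fun ω => key (P' ω)
  rw [hk, hk', ← Measure.map_map hΨ hm, ← Measure.map_map hΨ hm', hlaw]

/-- The intensity measure determines the law of a Poisson process. -/
theorem map_config_eq [IsProbabilityMeasure μ] [IsProbabilityMeasure ν]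
    (hP : IsPoissonProcess μ Λ P) (hP' : IsPoissonProcess ν Λ P') :
    μ.map (fun ω => (⟨P ω⟩ : Config α)) = ν.map fun ω => (⟨P' ω⟩ : Config α) := by
  have hc := hP.measurable_config
  have hc' := hP'.measurable_config
  have hN := Config.measurable_counts.comp hc
  have hN' := Config.measurable_counts.comp hc'
  have hlaw : μ.map (Config.counts ∘ fun ω => (⟨P ω⟩ : Config α)) =
      ν.map (Config.counts ∘ fun ω => (⟨P' ω⟩ : Config α)) := by
    have : ∀ I : Finset {B : Set α // MeasurableSet B}, IsFiniteMeasure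
        ((ν.map (Config.counts ∘ fun ω => (⟨P' ω⟩ : Config α))).map I.restrict) := by
      intro I
      infer_instance
    refine IsProjectiveLimit.unique (P := fun I =>
      (ν.map (Config.counts ∘ fun ω => (⟨P' ω⟩ : Config α))).map I.restrict) ?_ fun _ => rfl
    intro I
    beta_reduce
    rw [Measure.map_map (Finset.measurable_restrict I) hN,
      Measure.map_map (Finset.measurable_restrict I) hN']
    exact hP.map_counts_eq hP' (B := fun j : I => j.1.1) fun j => j.1.2
  ext s hs
  obtain ⟨V, hV, rfl⟩ := hs
  have h := congrArg (fun m => m V) hlaw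
  simp only [Measure.map_apply hN hV, Measure.map_apply hN' hV] at h
  rw [Measure.map_apply hc (Config.measurable_counts hV),
    Measure.map_apply hc' (Config.measurable_counts hV)]
  exact h

/-- The points of a Poisson process in a measurable set form a Poisson process. -/
theorem restrict (hP : IsPoissonProcess μ Λ P) {W : Set α} (hW : MeasurableSet W) :
    IsPoissonProcess μ (Λ.restrict W) fun ω => P ω ∩ W := by
  have h : ∀ ω B, P ω ∩ W ∩ B = P ω ∩ (B ∩ W) := fun ω B => by
    rw [Set.inter_assoc, Set.inter_comm W]
  refine ⟨fun B hB => ?_, fun B hB hfin => ?_, fun B hB htop => ?_, fun k B hB hdisj => ?_⟩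
  · simpa only [h] using hP.measurable_count _ (hB.inter hW)
  · rw [Measure.restrict_apply hB] at hfin ⊢
    simpa only [h] using hP.count_law _ (hB.inter hW) hfin
  · rw [Measure.restrict_apply hB] at htop
    simpa only [h] using hP.count_top _ (hB.inter hW) htop
  · simpa only [h] using hP.indep k (fun i => B i ∩ W) (fun i => (hB i).inter hW)
      fun i j hij => (hdisj hij).mono Set.inter_subset_left Set.inter_subset_left

/-- The law of a Poisson process is invariant under involutions that preserve the intensity. -/
theorem preimage (hP : IsPoissonProcess μ Λ P) {f : α → α} (hf : Function.Involutive f)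
    (hfΛ : MeasurePreserving f Λ Λ) : IsPoissonProcess μ Λ fun ω => f ⁻¹' P ω := by
  have h : ∀ ω B, (f ⁻¹' P ω ∩ B).encard = (P ω ∩ f ⁻¹' B).encard := fun ω B => by
    have : f ⁻¹' P ω ∩ B = f '' (P ω ∩ f ⁻¹' B) := by
      rw [hf.image_eq_preimage_symm, Set.preimage_inter, ← Set.preimage_comp, hf.comp_self,
        Set.preimage_id]
    rw [this, hf.injective.encard_image]
  refine ⟨fun B hB => ?_, fun B hB hfin => ?_, fun B hB htop => ?_, fun k B hB hdisj => ?_⟩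
  · simpa only [h] using hP.measurable_count _ (hfΛ.measurable hB)
  · rw [← hfΛ.measure_preimage hB.nullMeasurableSet] at hfin ⊢
    simpa only [h] using hP.count_law _ (hfΛ.measurable hB) hfin
  · rw [← hfΛ.measure_preimage hB.nullMeasurableSet] at htop
    simpa only [h] using hP.count_top _ (hfΛ.measurable hB) htop
  · simpa only [h] using hP.indep k (fun i => f ⁻¹' B i) (fun i => hfΛ.measurable (hB i))
      fun i j hij => (hdisj hij).preimage f

theorem measure_le_count (hP : IsPoissonProcess μ Λ P) {B : Set α} (hB : MeasurableSet B)
    (hfin : Λ B ≠ ∞) (k : ℕ) :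
    μ {ω | (k : ℕ∞) ≤ (P ω ∩ B).encard} = poissonMeasure (Λ B).toNNReal {n | k ≤ n} := by
  have h := congrArg (fun m => m (Set.Ici (k : ℕ∞))) (hP.count_law B hB hfin)
  rw [Measure.map_apply (hP.measurable_count B hB) .of_discrete,
    Measure.map_apply .of_discrete .of_discrete] at h
  simpa [Set.preimage] using h

theorem ae_finite (hP : IsPoissonProcess μ Λ P) {B : Set α} (hB : MeasurableSet B)
    (hfin : Λ B ≠ ∞) : ∀ᵐ ω ∂μ, (P ω ∩ B).Finite := by
  have h := congrArg (fun m => m {(⊤ : ℕ∞)}) (hP.count_law B hB hfin)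
  rw [Measure.map_apply (hP.measurable_count B hB) .of_discrete,
    Measure.map_apply .of_discrete .of_discrete] at h
  have h0 : (fun k : ℕ => (k : ℕ∞)) ⁻¹' {⊤} = ∅ := by
    ext k
    simp
  rw [h0, measure_empty] at h
  refine measure_mono_null (fun ω hω => ?_) h
  simpa [Set.encard_eq_top_iff] using hω

theorem measure_nonempty_le (hP : IsPoissonProcess μ Λ P) {B : Set α} (hB : MeasurableSet B)
    (hfin : Λ B ≠ ∞) : μ {ω | 1 ≤ (P ω ∩ B).encard} ≤ Λ B := by
  have h := hP.measure_le_count hB hfin 1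
  rw [Nat.cast_one] at h
  have hc : {n : ℕ | 1 ≤ n} = {0}ᶜ := by ext n; simp [Nat.one_le_iff_ne_zero]
  rw [h, hc, prob_compl_eq_one_sub .of_discrete, poissonMeasure_singleton,
    ← ENNReal.ofReal_one, ← ENNReal.ofReal_sub _ (by positivity)]
  refine (ENNReal.ofReal_le_ofReal (q := ((Λ B).toNNReal : ℝ)) ?_).trans ?_
  · have := Real.add_one_le_exp (-((Λ B).toNNReal : ℝ))
    simp only [pow_zero, mul_one, Nat.factorial_zero, Nat.cast_one, div_one]
    linarith
  · rw [ENNReal.ofReal_coe_nnreal, ENNReal.coe_toNNReal hfin]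

theorem measure_two_le (hP : IsPoissonProcess μ Λ P) {B : Set α} (hB : MeasurableSet B)
    (hfin : Λ B ≠ ∞) : μ {ω | 2 ≤ (P ω ∩ B).encard} ≤ Λ B ^ 2 := by
  have h := hP.measure_le_count hB hfin 2
  rw [Nat.cast_ofNat] at h
  have hc : {n : ℕ | 2 ≤ n} = ({0} ∪ {1})ᶜ := by
    ext n
    simp only [Set.mem_ofPred_eq, Set.mem_compl_iff, Set.mem_union, Set.mem_singleton_iff]
    omega
  rw [h, hc, prob_compl_eq_one_sub .of_discrete,
    measure_union (by simp) .of_discrete, poissonMeasure_singleton, poissonMeasure_singleton,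
    ← ENNReal.ofReal_add (by positivity) (by positivity), ← ENNReal.ofReal_one,
    ← ENNReal.ofReal_sub _ (by positivity)]
  set r : ℝ := ((Λ B).toNNReal : ℝ) with hr
  refine (ENNReal.ofReal_le_ofReal (q := r ^ 2) ?_).trans ?_
  · have h1 := Real.add_one_le_exp (-r)
    have h2 : (1 + r) * (1 - r) ≤ (1 + r) * Real.exp (-r) := by
      gcongr
      linarith
    simp only [pow_zero, mul_one, Nat.factorial_zero, Nat.cast_one, div_one, pow_one,
      Nat.factorial_one]
    nlinarith
  · rw [ENNReal.ofReal_pow (by positivity), hr, ENNReal.ofReal_coe_nnreal,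
      ENNReal.coe_toNNReal hfin]

end IsPoissonProcess

section Intensity

variable {d : ℕ}

/-- The intensity of the marked process with arrival times in `[0, t]`. -/
def windowIntensity (d : ℕ) (F : Measure ℝ) (t : ℝ) : Measure (Particle d) :=
  (volume : Measure (Space d)).prod (((volume : Measure ℝ).restrict (Set.Icc 0 t)).prod F)

theorem intensity_restrict (F : Measure ℝ) [IsProbabilityMeasure F] (t : ℝ) :
    (intensity d F).restrict {p | p.time ∈ Set.Icc 0 t} = windowIntensity d F t := by
  have h : {p : Particle d | p.time ∈ Set.Icc 0 t} =
      Set.univ ×ˢ (Set.Icc 0 t ×ˢ Set.univ) := by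
    ext p
    simp [Particle.time]
  rw [h, intensity, windowIntensity, ← Measure.prod_restrict, ← Measure.prod_restrict,
    Measure.restrict_univ, Measure.restrict_univ, Measure.restrict_restrict measurableSet_Icc,
    Set.inter_eq_left.2 fun x hx => hx.1]

theorem measurePreserving_reflect (F : Measure ℝ) [IsProbabilityMeasure F] (t : ℝ) :
    MeasurePreserving (reflect t) (windowIntensity d F t) (windowIntensity d F t) := by
  have h : MeasurePreserving (fun s : ℝ => t - s) (volume.restrict (Set.Icc 0 t))
      (volume.restrict (Set.Icc 0 t)) := by
    have := (Measure.measurePreserving_sub_left (volume : Measure ℝ) t).restrict_preimage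
      (s := Set.Icc 0 t) measurableSet_Icc
    simpa using this
  exact (MeasurePreserving.id volume).prod (h.prod (MeasurePreserving.id F))

theorem windowIntensity_prod (F : Measure ℝ) [IsProbabilityMeasure F] (t : ℝ) (W : Set (Space d))
    (I : Set ℝ) :
    windowIntensity d F t (W ×ˢ (I ×ˢ Set.univ)) =
      volume W * volume.restrict (Set.Icc 0 t) I := by
  rw [windowIntensity, Measure.prod_prod, Measure.prod_prod, measure_univ, mul_one]

theorem volume_cubes_singleton (z : Fin d → ℤ) : volume (cubes {z}) = 1 := by
  have h : cubes {z} = (WithLp.ofLp : Space d → Fin d → ℝ) ⁻¹'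
      (Set.univ.pi fun i => Set.Ico (z i : ℝ) (z i + 1)) := by
    ext x
    simp [cubes]
  rw [h, (PiLp.volume_preserving_ofLp (Fin d)).measure_preimage
    (MeasurableSet.univ_pi fun i => measurableSet_Ico).nullMeasurableSet, Real.volume_pi_Ico]
  simp

theorem cubes_eq_biUnion (Q : Finset (Fin d → ℤ)) : cubes Q = ⋃ z ∈ Q, cubes {z} := by
  ext x
  simp [mem_cubes]

theorem volume_cubes_le (Q : Finset (Fin d → ℤ)) : volume (cubes Q) ≤ Q.card := by
  rw [cubes_eq_biUnion]
  refine (measure_biUnion_finset_le _ _).trans ?_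
  simp [volume_cubes_singleton]

end Intensity

/-! ### Almost sure finiteness of the set of reached particles -/

section LatticePaths

variable {d : ℕ}

/-- The lattice points at sup-distance at most `M` from `z`. -/
def nbr (M : ℕ) (z : Fin d → ℤ) : Finset (Fin d → ℤ) :=
  Fintype.piFinset fun i => Finset.Icc (z i - M) (z i + M)

theorem card_nbr (M : ℕ) (z : Fin d → ℤ) : (nbr M z).card = (2 * M + 1) ^ d := by
  rw [nbr, Fintype.card_piFinset]
  have h : ∀ i, (Finset.Icc (z i - M) (z i + M)).card = 2 * M + 1 := by
    intro i
    rw [Int.card_Icc]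
    omega
  simp [h]

open Classical in
/-- The lists `z₁, …, zₖ` of lattice points such that consecutive members of `z, z₁, …, zₖ` are
neighbours. -/
def paths (M : ℕ) : ℕ → (Fin d → ℤ) → Finset (List (Fin d → ℤ))
  | 0, _ => {[]}
  | k + 1, z => (nbr M z).biUnion fun w => (paths M k w).image (List.cons w)

theorem card_paths_le (M k : ℕ) (z : Fin d → ℤ) :
    (paths M k z).card ≤ ((2 * M + 1) ^ d) ^ k := by
  induction k generalizing z with
  | zero => simp [paths]
  | succ k ih =>
    rw [paths]
    refine Finset.card_biUnion_le.trans ?_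
    refine (Finset.sum_le_sum fun w _ => Finset.card_image_le.trans (ih w)).trans ?_
    rw [Finset.sum_const, card_nbr, smul_eq_mul, pow_succ']

theorem mem_paths {M k : ℕ} {z : Fin d → ℤ} {l : List (Fin d → ℤ)} :
    l ∈ paths M k z ↔ l.length = k ∧ (z :: l).IsChain fun z w => w ∈ nbr M z := by
  induction k generalizing z l with
  | zero =>
    simp only [paths, Finset.mem_singleton, List.length_eq_zero_iff]
    constructor
    · rintro rfl
      exact ⟨rfl, .singleton _⟩
    · exact fun h => h.1
  | succ k ih =>
    simp only [paths, Finset.mem_biUnion, Finset.mem_image, ih]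
    constructor
    · rintro ⟨w, hw, l, ⟨hl, hc⟩, rfl⟩
      exact ⟨by simp [hl], List.isChain_cons_cons.2 ⟨hw, hc⟩⟩
    · rintro ⟨hl, hc⟩
      cases l with
      | nil => simp at hl
      | cons w l =>
        rw [List.isChain_cons_cons] at hc
        exact ⟨w, hc.1, l, ⟨by simpa using hl, hc.2⟩, rfl⟩

/-- A point that can be reached is the end of a path without repetitions. -/
theorem exists_nodup_isChain {V : Type*} {r : V → V → Prop} {a b : V}
    (h : Relation.ReflTransGen r a b) :
    ∃ l : List V, (a :: l).IsChain r ∧ (a :: l).Nodup ∧ (a :: l).getLast (by simp) = b := by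
  induction h using Relation.ReflTransGen.head_induction_on with
  | refl => exact ⟨[], .singleton _, by simp, rfl⟩
  | @head a c hac _ ih =>
    obtain ⟨l, hc, hn, hl⟩ := ih
    by_cases ha : a ∈ c :: l
    · obtain ⟨s, u, hsu⟩ := List.append_of_mem ha
      refine ⟨u, ?_, ?_, ?_⟩
      · exact hc.suffix ⟨s, hsu.symm⟩
      · exact hn.sublist (List.IsSuffix.sublist ⟨s, hsu.symm⟩)
      · rw [← hl]
        simp only [hsu]
        rw [List.getLast_append_of_ne_nil]
    · exact ⟨c :: l, List.isChain_cons_cons.2 ⟨hac, hc⟩, List.nodup_cons.2 ⟨ha, hn⟩, by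
        rw [List.getLast_cons (by simp)]; exact hl⟩

theorem forall_mem_of_isChain {V : Type*} {r : V → V → Prop} {o : V → Prop}
    (hr : ∀ z w, r z w → o w) {z : V} {l : List V} (h : (z :: l).IsChain r) : ∀ w ∈ l, o w := by
  induction l generalizing z with
  | nil => simp
  | cons v l ih =>
    rw [List.isChain_cons_cons] at h
    intro w hw
    rcases List.mem_cons.1 hw with rfl | hw
    · exact hr _ _ h.1
    · exact ih h.2 w hw

/-- If self-avoiding paths of occupied sites have bounded length, clusters are finite. -/
theorem finite_cluster {M K : ℕ} {o : (Fin d → ℤ) → Prop} {z : Fin d → ℤ}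
    (h : ∀ l ∈ paths M K z, l.Nodup → ¬ ∀ w ∈ l, o w) :
    {w | Relation.ReflTransGen (fun z w => w ∈ nbr M z ∧ o w) z w}.Finite := by
  classical
  refine ((Finset.range K).biUnion fun k => (paths M k z).image fun l =>
    (z :: l).getLast (by simp)).finite_toSet.subset fun w hw => ?_
  obtain ⟨l, hc, hn, hl⟩ := exists_nodup_isChain hw
  have ho := forall_mem_of_isChain (o := o) (fun _ _ h => h.2) hc
  have hc' : (z :: l).IsChain fun z w => w ∈ nbr M z := hc.imp fun _ _ h => h.1
  simp only [Finset.coe_biUnion, Set.mem_iUnion, Finset.mem_coe, Finset.mem_image,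
    Finset.mem_range]
  refine ⟨l.length, ?_, l, mem_paths.2 ⟨rfl, hc'⟩, hl⟩
  by_contra! hK
  refine h (l.take K) (mem_paths.2 ⟨by simpa using hK, hc'.take (K + 1)⟩)
    ((List.nodup_cons.1 hn).2.sublist (List.take_sublist K l)) fun w hw =>
      ho w (List.mem_of_mem_take hw)

end LatticePaths

section Slabs

variable {d : ℕ}

/-- The particles over `cubes Q` that arrive in the `j`-th time slab of width `1 / κ`. -/
def box (Q : Finset (Fin d → ℤ)) (κ j : ℕ) : Set (Particle d) :=
  cubes Q ×ˢ (Set.Ico ((j : ℝ) / κ) ((j + 1 : ℝ) / κ) ×ˢ Set.univ)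

theorem measurableSet_box (Q : Finset (Fin d → ℤ)) (κ j : ℕ) : MeasurableSet (box Q κ j) :=
  (measurableSet_cubes Q).prod (measurableSet_Ico.prod .univ)

theorem mem_box {Q : Finset (Fin d → ℤ)} {κ : ℕ} (hκ : 0 < κ) {p : Particle d}
    (hp : 0 ≤ p.time) {j : ℕ} : p ∈ box Q κ j ↔ cell p.loc ∈ Q ∧ ⌊p.time * κ⌋₊ = j := by
  have hκ' : (0 : ℝ) < κ := by exact_mod_cast hκ
  rw [Nat.floor_eq_iff (by positivity), ← mem_cubes]
  change p.loc ∈ _ ∧ ((_ ≤ p.time ∧ p.time < _) ∧ True) ↔ _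
  rw [div_le_iff₀ hκ', lt_div_iff₀ hκ']
  simp

theorem windowIntensity_box_le (F : Measure ℝ) [IsProbabilityMeasure F] (t : ℝ)
    (Q : Finset (Fin d → ℤ)) (κ j : ℕ) :
    windowIntensity d F t (box Q κ j) ≤ ENNReal.ofReal (Q.card / κ) := by
  rw [box, windowIntensity_prod, div_eq_mul_inv (Q.card : ℝ), ENNReal.ofReal_mul (by positivity),
    ENNReal.ofReal_natCast]
  refine mul_le_mul' (volume_cubes_le Q) ((Measure.restrict_apply_le _ _).trans ?_)
  rw [Real.volume_Ico]
  refine ENNReal.ofReal_le_ofReal (le_of_eq ?_)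
  ring

theorem windowIntensity_box_ne_top (F : Measure ℝ) [IsProbabilityMeasure F] (t : ℝ)
    (Q : Finset (Fin d → ℤ)) (κ j : ℕ) : windowIntensity d F t (box Q κ j) ≠ ∞ :=
  ((windowIntensity_box_le F t Q κ j).trans_lt ENNReal.ofReal_lt_top).ne

/-- Particles that touch have positions in neighbouring cells. -/
theorem cell_mem_nbr {q p : Particle d} {R : ℝ} {M : ℕ} (hM : 2 * R + 1 ≤ M)
    (hq : q.radius ≤ R) (hp : p.radius ≤ R) (h : link q p ≠ ⊥) :
    cell p.loc ∈ nbr M (cell q.loc) := by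
  have hdist : dist q.loc p.loc ≤ 2 * R := by
    by_contra! hlt
    refine h (if_neg ?_)
    linarith
  rw [nbr, Fintype.mem_piFinset]
  intro i
  have hi : |q.loc i - p.loc i| ≤ 2 * R := by
    refine le_trans ?_ hdist
    rw [dist_eq_norm]
    exact PiLp.norm_apply_le (q.loc - p.loc) i
  rw [abs_le] at hi
  rw [Finset.mem_Icc, cell, cell]
  have h1 := Int.floor_le (q.loc i)
  have h2 := Int.lt_floor_add_one (q.loc i)
  have h3 := Int.floor_le (p.loc i)
  have h4 := Int.lt_floor_add_one (p.loc i)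
  constructor
  · have : (⌊q.loc i⌋ : ℝ) - M ≤ ⌊p.loc i⌋ := by linarith
    exact_mod_cast this
  · have : (⌊p.loc i⌋ : ℝ) ≤ ⌊q.loc i⌋ + M := by linarith
    exact_mod_cast this

/-- If in each time slab the clusters of occupied cells are finite, only finitely many particles
are reached before any given time. -/
theorem finite_reached {S : Set (Particle d)} {t R : ℝ} (hR : 0 ≤ R) {M κ : ℕ} (hκ : 0 < κ)
    (hM : 2 * R + 1 ≤ M) (hrad : ∀ p ∈ S, p.radius ≤ R)
    (htime : ∀ p ∈ S, p.time ∈ Set.Icc 0 t)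
    (hfin : ∀ Q : Finset (Fin d → ℤ), (S ∩ {p | p.loc ∈ cubes Q}).Finite)
    (hclus : ∀ (j : ℕ) (z : Fin d → ℤ), {w | Relation.ReflTransGen
      (fun z w => w ∈ nbr M z ∧ (S ∩ box {w} κ j).Nonempty) z w}.Finite) :
    {p | Reached S p}.Finite := by
  have key : ∀ j : ℕ, {p | Reached S p ∧ ⌊p.time * κ⌋₊ < j}.Finite := by
    intro j
    induction j with
    | zero => simp
    | succ j ih =>
      -- the cells from which the deposit can grow during the `j`-th slab
      let Z : Set (Fin d → ℤ) :=
        insert 0 ((fun p => cell p.loc) '' {p | Reached S p ∧ ⌊p.time * κ⌋₊ < j})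
      have hZ : Z.Finite := (ih.image _).insert _
      have hC := hZ.biUnion fun z _ => hclus j z
      set C := ⋃ z ∈ Z, {w | Relation.ReflTransGen
        (fun z w => w ∈ nbr M z ∧ (S ∩ box {w} κ j).Nonempty) z w} with hCdef
      have hmem : ∀ p, Reached S p → ⌊p.time * κ⌋₊ = j → cell p.loc ∈ C := by
        intro p hp
        have hocc : ∀ p ∈ S, ⌊p.time * κ⌋₊ = j → (S ∩ box {cell p.loc} κ j).Nonempty :=
          fun p hp hpj => ⟨p, hp, (mem_box hκ (htime p hp).1).2 ⟨by simp, hpj⟩⟩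
        induction hp with
        | @base p hpS hl =>
          intro hpj
          have h0 : cell (probe (0 : Space d)).loc = 0 := by
            ext i
            simp [cell, probe, Particle.loc]
          have hn := cell_mem_nbr hM (q := probe 0) hR (hrad p hpS) hl
          rw [h0] at hn
          exact Set.mem_biUnion (Set.mem_insert _ _)
            (Relation.ReflTransGen.single ⟨hn, hocc p hpS hpj⟩)
        | @step q p hq hpS hqp hl ih' =>
          intro hpj
          have hn := cell_mem_nbr hM (hrad q hq.mem) (hrad p hpS) hl
          have hle : ⌊q.time * κ⌋₊ ≤ j := by
            rw [← hpj]
            gcongr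
          rcases hle.lt_or_eq with hlt | heq
          · exact Set.mem_biUnion (Set.mem_insert_of_mem _ ⟨q, ⟨hq, hlt⟩, rfl⟩)
              (Relation.ReflTransGen.single ⟨hn, hocc p hpS hpj⟩)
          · obtain ⟨z, hz, hzq⟩ := Set.mem_iUnion₂.1 (ih' heq)
            exact Set.mem_biUnion hz (Relation.ReflTransGen.tail hzq ⟨hn, hocc p hpS hpj⟩)
      refine (ih.union (hfin hC.toFinset)).subset ?_
      rintro p ⟨hp, hpj⟩
      rcases (Nat.lt_succ_iff.1 hpj).lt_or_eq with hlt | heq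
      · exact Or.inl ⟨hp, hlt⟩
      · refine Or.inr ⟨hp.mem, ?_⟩
        rw [Set.mem_ofPred_eq, mem_cubes, Set.Finite.mem_toFinset]
        exact hmem p hp heq
  refine (key (⌊t * κ⌋₊ + 1)).subset fun p hp => ⟨hp, Nat.lt_succ_iff.2 ?_⟩
  gcongr
  exact (htime p (Reached.mem hp)).2

end Slabs

section AlmostSure

variable {Ω : Type*} [MeasurableSpace Ω] {μ : Measure Ω} {d : ℕ} {F : Measure ℝ}
  [IsProbabilityMeasure F] {t : ℝ} {P : Ω → Set (Particle d)}

namespace IsPoissonProcess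

theorem ae_inter_eq_empty {α : Type*} [MeasurableSpace α] {Λ : Measure α} {P : Ω → Set α}
    (hP : IsPoissonProcess μ Λ P) {B : Set α} (hB : MeasurableSet B) (h : Λ B = 0) :
    ∀ᵐ ω ∂μ, P ω ∩ B = ∅ := by
  have h0 := hP.measure_nonempty_le hB (by simp [h])
  rw [h, nonpos_iff_eq_zero] at h0
  refine measure_mono_null (fun ω hω => ?_) h0
  rw [Set.mem_ofPred_eq, Set.one_le_encard_iff_nonempty]
  exact Set.nonempty_iff_ne_empty.2 hω

theorem ae_time_mem (hP : IsPoissonProcess μ (windowIntensity d F t) P) :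
    ∀ᵐ ω ∂μ, ∀ p ∈ P ω, p.time ∈ Set.Icc 0 t := by
  have h0 : windowIntensity d F t (Set.univ ×ˢ ((Set.Icc 0 t)ᶜ ×ˢ Set.univ)) = 0 := by
    rw [windowIntensity_prod, Measure.restrict_apply measurableSet_Icc.compl]
    simp
  filter_upwards [hP.ae_inter_eq_empty
    (MeasurableSet.univ.prod (measurableSet_Icc.compl.prod .univ)) h0] with ω hω p hp
  by_contra hcon
  have : p ∈ P ω ∩ Set.univ ×ˢ ((Set.Icc 0 t)ᶜ ×ˢ Set.univ) := ⟨hp, trivial, hcon, trivial⟩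
  rw [hω] at this
  exact this

theorem ae_radius_mem {R : ℝ} (hF : ∀ᵐ r ∂F, 0 < r ∧ r ≤ R)
    (hP : IsPoissonProcess μ (windowIntensity d F t) P) :
    ∀ᵐ ω ∂μ, ∀ p ∈ P ω, 0 < p.radius ∧ p.radius ≤ R := by
  have h0 : windowIntensity d F t (Set.univ ×ˢ (Set.univ ×ˢ (Set.Ioc 0 R)ᶜ)) = 0 := by
    rw [windowIntensity, Measure.prod_prod, Measure.prod_prod]
    have : F (Set.Ioc 0 R)ᶜ = 0 := hF
    simp [this]
  filter_upwards [hP.ae_inter_eq_empty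
    (MeasurableSet.univ.prod (MeasurableSet.univ.prod measurableSet_Ioc.compl)) h0] with ω hω p hp
  by_contra hcon
  have : p ∈ P ω ∩ Set.univ ×ˢ (Set.univ ×ˢ (Set.Ioc 0 R)ᶜ) := ⟨hp, trivial, trivial, hcon⟩
  rw [hω] at this
  exact this

theorem ae_finite_inter (hP : IsPoissonProcess μ (windowIntensity d F t) P) :
    ∀ᵐ ω ∂μ, ∀ Q : Finset (Fin d → ℤ), (P ω ∩ {p | p.loc ∈ cubes Q}).Finite := by
  rw [ae_all_iff]
  intro Q
  have hset : {p : Particle d | p.loc ∈ cubes Q} = cubes Q ×ˢ (Set.univ ×ˢ Set.univ) := by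
    ext p
    simp [Particle.loc]
  refine hP.ae_finite (measurable_loc (measurableSet_cubes Q)) ?_
  rw [hset, windowIntensity_prod, Measure.restrict_apply_univ, Real.volume_Icc]
  exact ENNReal.mul_ne_top
    ((volume_cubes_le Q).trans_lt (ENNReal.natCast_lt_top _)).ne ENNReal.ofReal_ne_top

theorem measure_two_le_box (hP : IsPoissonProcess μ (windowIntensity d F t) P)
    (Q : Finset (Fin d → ℤ)) (κ j : ℕ) :
    μ {ω | 2 ≤ (P ω ∩ box Q κ j).encard} ≤ ENNReal.ofReal ((Q.card / κ) ^ 2) := by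
  refine (hP.measure_two_le (measurableSet_box Q κ j)
    (windowIntensity_box_ne_top F t Q κ j)).trans ?_
  rw [ENNReal.ofReal_pow (by positivity)]
  gcongr
  exact windowIntensity_box_le F t Q κ j

/-- Almost surely no two particles arrive at the same time: the probability that one of the slabs
of width `1 / κ` contains two particles over a given bounded region is of order `1 / κ`. -/
theorem ae_injOn_time (hP : IsPoissonProcess μ (windowIntensity d F t) P) :
    ∀ᵐ ω ∂μ, (P ω).InjOn Particle.time := by
  have hbox : ∀ Q : Finset (Fin d → ℤ), ∀ᵐ ω ∂μ, ∃ m : ℕ, ∀ j < (⌈t⌉₊ + 1) * (m + 1),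
      ¬ 2 ≤ (P ω ∩ box Q (m + 1) j).encard := by
    intro Q
    set c : ℝ := (⌈t⌉₊ + 1) * (Q.card : ℝ) ^ 2 with hc
    have hbound : ∀ m : ℕ, μ {ω | ¬ ∃ m : ℕ, ∀ j < (⌈t⌉₊ + 1) * (m + 1),
        ¬ 2 ≤ (P ω ∩ box Q (m + 1) j).encard} ≤ ENNReal.ofReal (c * (1 / ((m : ℝ) + 1))) := by
      intro m
      calc μ {ω | ¬ ∃ m : ℕ, ∀ j < (⌈t⌉₊ + 1) * (m + 1),
              ¬ 2 ≤ (P ω ∩ box Q (m + 1) j).encard}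
          ≤ μ (⋃ j ∈ Finset.range ((⌈t⌉₊ + 1) * (m + 1)),
              {ω | 2 ≤ (P ω ∩ box Q (m + 1) j).encard}) := by
            refine measure_mono fun ω hω => ?_
            rw [Set.mem_ofPred_eq] at hω
            push Not at hω
            obtain ⟨j, hj, h2⟩ := hω m
            exact Set.mem_biUnion (Finset.mem_coe.2 (Finset.mem_range.2 hj)) h2
        _ ≤ ∑ j ∈ Finset.range ((⌈t⌉₊ + 1) * (m + 1)),
              ENNReal.ofReal ((Q.card / ((m + 1 : ℕ) : ℝ)) ^ 2) :=
            (measure_biUnion_finset_le _ _).trans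
              (Finset.sum_le_sum fun j _ => hP.measure_two_le_box Q (m + 1) j)
        _ = ENNReal.ofReal (c * (1 / ((m : ℝ) + 1))) := by
            rw [Finset.sum_const, Finset.card_range, nsmul_eq_mul, ← ENNReal.ofReal_natCast,
              ← ENNReal.ofReal_mul (by positivity)]
            congr 1
            rw [hc]
            push_cast
            field_simp
    have hlim : Tendsto (fun m : ℕ => ENNReal.ofReal (c * (1 / ((m : ℝ) + 1)))) atTop (𝓝 0) := by
      have := ENNReal.tendsto_ofReal ((tendsto_one_div_add_atTop_nhds_zero_nat (𝕜 := ℝ)).const_mul c)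
      simpa using this
    exact nonpos_iff_eq_zero.1 (ge_of_tendsto' hlim hbound)
  filter_upwards [ae_all_iff.2 hbox, hP.ae_time_mem] with ω hω htime p hp q hq hpq
  by_contra hne
  obtain ⟨m, hm⟩ := hω {cell p.loc, cell q.loc}
  have hlt : ⌊p.time * (m + 1 : ℕ)⌋₊ < (⌈t⌉₊ + 1) * (m + 1) := by
    rw [Nat.floor_lt (mul_nonneg (htime p hp).1 (by positivity))]
    push_cast
    have h1 := (htime p hp).2
    have h2 := Nat.le_ceil t
    gcongr
    linarith
  refine hm _ hlt ?_
  rw [← Set.encard_pair hne]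
  refine Set.encard_le_encard ?_
  rintro p' (rfl | rfl)
  · exact ⟨hp, (mem_box (Nat.succ_pos m) (htime _ hp).1).2 ⟨by simp, rfl⟩⟩
  · exact ⟨hq, (mem_box (Nat.succ_pos m) (htime _ hq).1).2 ⟨by simp, by rw [hpq]⟩⟩

/-- The numbers of particles in different cells are independent, and each cell is occupied with
probability at most `1 / κ`. -/
theorem measure_forall_occupied_le [IsProbabilityMeasure μ]
    (hP : IsPoissonProcess μ (windowIntensity d F t) P) (κ j : ℕ)
    {l : List (Fin d → ℤ)} (hl : l.Nodup) :
    μ {ω | ∀ w ∈ l, (P ω ∩ box {w} κ j).Nonempty} ≤ ENNReal.ofReal (1 / κ) ^ l.length := by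
  have hdisj : Pairwise fun a b : Fin l.length =>
      Disjoint (box {l.get a} κ j) (box {l.get b} κ j) := by
    intro a b hab
    refine Set.disjoint_left.2 fun p hpa hpb => hab (List.nodup_iff_injective_get.1 hl ?_)
    have ha := Finset.mem_singleton.1 (mem_cubes.1 hpa.1)
    have hb := Finset.mem_singleton.1 (mem_cubes.1 hpb.1)
    exact ha.symm.trans hb
  have hind := hP.indep l.length (fun a => box {l.get a} κ j)
    (fun a => measurableSet_box _ _ _) hdisj
  have hprod := hind.measure_inter_preimage_eq_mul Finset.univ (sets := fun _ => Set.Ici 1)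
    fun a _ => .of_discrete
  calc μ {ω | ∀ w ∈ l, (P ω ∩ box {w} κ j).Nonempty}
      ≤ μ (⋂ a ∈ (Finset.univ : Finset (Fin l.length)),
          (fun ω => (P ω ∩ box {l.get a} κ j).encard) ⁻¹' Set.Ici 1) := by
        refine measure_mono fun ω hω => Set.mem_iInter₂.2 fun a _ => ?_
        exact Set.one_le_encard_iff_nonempty.2 (hω _ (List.get_mem l a))
    _ = ∏ a : Fin l.length, μ ((fun ω => (P ω ∩ box {l.get a} κ j).encard) ⁻¹' Set.Ici 1) := hprod
    _ ≤ ∏ _a : Fin l.length, ENNReal.ofReal (1 / κ) := by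
        refine Finset.prod_le_prod' fun a _ => ?_
        refine (hP.measure_nonempty_le (measurableSet_box {l.get a} κ j)
          (windowIntensity_box_ne_top F t _ κ j)).trans ?_
        simpa using windowIntensity_box_le F t {l.get a} κ j
    _ = ENNReal.ofReal (1 / κ) ^ l.length := by simp

/-- In thin time slabs the clusters of occupied cells are almost surely finite. -/
theorem ae_finite_cluster [IsProbabilityMeasure μ]
    (hP : IsPoissonProcess μ (windowIntensity d F t) P) {M κ : ℕ}
    (hκ : 2 * (2 * M + 1) ^ d ≤ κ) :
    ∀ᵐ ω ∂μ, ∀ (j : ℕ) (z : Fin d → ℤ), {w | Relation.ReflTransGen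
      (fun z w => w ∈ nbr M z ∧ (P ω ∩ box {w} κ j).Nonempty) z w}.Finite := by
  simp only [ae_all_iff]
  intro j z
  have hN : 0 < (2 * M + 1) ^ d := by positivity
  have hκ0 : (0 : ℝ) < κ := by
    have : 0 < κ := by omega
    exact_mod_cast this
  have hbound : ∀ K : ℕ, μ {ω | ¬ ∃ K, ∀ l ∈ paths M K z, l.Nodup →
      ¬ ∀ w ∈ l, (P ω ∩ box {w} κ j).Nonempty} ≤ ENNReal.ofReal ((1 / 2) ^ K) := by
    intro K
    classical
    calc μ {ω | ¬ ∃ K, ∀ l ∈ paths M K z, l.Nodup →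
            ¬ ∀ w ∈ l, (P ω ∩ box {w} κ j).Nonempty}
        ≤ μ (⋃ l ∈ (paths M K z).filter List.Nodup,
            {ω | ∀ w ∈ l, (P ω ∩ box {w} κ j).Nonempty}) := by
          refine measure_mono fun ω hω => ?_
          rw [Set.mem_ofPred_eq] at hω
          push Not at hω
          obtain ⟨l, hl, hn, ho⟩ := hω K
          exact Set.mem_biUnion (Finset.mem_coe.2 (Finset.mem_filter.2 ⟨hl, hn⟩)) ho
      _ ≤ ∑ l ∈ (paths M K z).filter List.Nodup, ENNReal.ofReal (1 / κ) ^ K := by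
          refine (measure_biUnion_finset_le _ _).trans (Finset.sum_le_sum fun l hl => ?_)
          rw [Finset.mem_filter] at hl
          rw [← (mem_paths.1 hl.1).1]
          exact hP.measure_forall_occupied_le κ j hl.2
      _ ≤ ENNReal.ofReal ((1 / 2) ^ K) := by
          rw [Finset.sum_const, nsmul_eq_mul, ← ENNReal.ofReal_natCast,
            ← ENNReal.ofReal_pow (by positivity), ← ENNReal.ofReal_mul (by positivity)]
          refine ENNReal.ofReal_le_ofReal ?_
          have hcard : (((paths M K z).filter List.Nodup).card : ℝ) ≤
              (((2 * M + 1) ^ d : ℕ) : ℝ) ^ K := by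
            exact_mod_cast (Finset.card_filter_le _ _).trans (card_paths_le M K z)
          calc (((paths M K z).filter List.Nodup).card : ℝ) * (1 / κ) ^ K
              ≤ (((2 * M + 1) ^ d : ℕ) : ℝ) ^ K * (1 / κ) ^ K := by gcongr
            _ = ((((2 * M + 1) ^ d : ℕ) : ℝ) / κ) ^ K := by rw [← mul_pow]; ring
            _ ≤ (1 / 2) ^ K := by
                have h2 : 2 * (((2 * M + 1) ^ d : ℕ) : ℝ) ≤ κ := by exact_mod_cast hκ
                gcongr ?_ ^ K
                rw [div_le_div_iff₀ hκ0 two_pos]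
                linarith
  have hlim : Tendsto (fun K : ℕ => ENNReal.ofReal ((1 / 2) ^ K)) atTop (𝓝 0) := by
    have := ENNReal.tendsto_ofReal
      (tendsto_pow_atTop_nhds_zero_of_lt_one (r := (1 / 2 : ℝ)) (by norm_num) (by norm_num))
    simpa using this
  have h0 : ∀ᵐ ω ∂μ, ∃ K, ∀ l ∈ paths M K z, l.Nodup →
      ¬ ∀ w ∈ l, (P ω ∩ box {w} κ j).Nonempty :=
    nonpos_iff_eq_zero.1 (ge_of_tendsto' hlim hbound)
  filter_upwards [h0] with ω hω
  obtain ⟨K, hK⟩ := hω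
  exact finite_cluster hK

theorem ae_isRegular [IsProbabilityMeasure μ] {R : ℝ} (hF : ∀ᵐ r ∂F, 0 < r ∧ r ≤ R)
    (hP : IsPoissonProcess μ (windowIntensity d F t) P) : ∀ᵐ ω ∂μ, IsRegular t (P ω) := by
  have hR : 0 ≤ R := by
    obtain ⟨r, hr⟩ := hF.exists
    linarith [hr.1, hr.2]
  obtain ⟨M, hM⟩ := exists_nat_ge (2 * R + 1)
  have hN : 0 < (2 * M + 1) ^ d := by positivity
  filter_upwards [hP.ae_radius_mem hF, hP.ae_time_mem, hP.ae_finite_inter, hP.ae_injOn_time,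
    hP.ae_finite_cluster (M := M) le_rfl] with ω hrad htime hfin hinj hclus
  exact ⟨fun p hp => (hrad p hp).1.le, htime, hinj, hfin,
    finite_reached hR (by omega) hM (fun p hp => (hrad p hp).2) htime hfin hclus⟩

end IsPoissonProcess

end AlmostSure

/-! ### Equality of the distributions -/

section Duality

variable {Ω : Type*} [MeasurableSpace Ω] {μ : Measure Ω} {d : ℕ}

theorem restriction_inter_time (S : Set (Particle d)) (W : Set (Space d)) (t : ℝ) :
    restriction (S ∩ {p | p.time ∈ Set.Icc 0 t}) W t = restriction S W t := by
  ext p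
  constructor
  · rintro ⟨⟨h1, -⟩, h2⟩
    exact ⟨h1, h2⟩
  · rintro ⟨h1, h2⟩
    exact ⟨⟨h1, h2.2⟩, h2⟩

/-- On regular realisations with regular time reversal, the flat height at the origin is eventually
equal to the maximal height of the dual deposit. -/
theorem IsRegular.eventually_flatHeight_eq {t : ℝ} {S : Set (Particle d)} (hS : IsRegular t S)
    (hS' : IsRegular t (reflect t ⁻¹' S)) {Q : ℕ → Finset (Fin d → ℤ)}
    (hQ : ∀ z : Fin d → ℤ, ∀ᶠ n in atTop, z ∈ Q n) :
    ∀ᶠ n in atTop, flatHeight Q S t n 0 = seedDepth Q (reflect t ⁻¹' S) t := by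
  filter_upwards [hQ 0, hS'.eventually_iSup_seedHeight hQ] with n h0 hn
  rw [hS.flatHeight_eq h0 hS', hn]

theorem IsRegular.infiniteFlatHeight_eq {t : ℝ} {S : Set (Particle d)} (hS : IsRegular t S)
    (hS' : IsRegular t (reflect t ⁻¹' S)) {Q : ℕ → Finset (Fin d → ℤ)}
    (hQ : ∀ z : Fin d → ℤ, ∀ᶠ n in atTop, z ∈ Q n) :
    infiniteFlatHeight Q S t 0 = seedDepth Q (reflect t ⁻¹' S) t := by
  rw [infiniteFlatHeight, limsup_congr (hS.eventually_flatHeight_eq hS' hQ), limsup_const]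

/-- The dual depths of two Poisson processes with the same intensity have the same distribution. -/
theorem IsPoissonProcess.identDistrib_seedDepth [IsProbabilityMeasure μ] {F : Measure ℝ}
    [IsProbabilityMeasure F] {R t : ℝ} (hF : ∀ᵐ r ∂F, 0 < r ∧ r ≤ R)
    {P P' : Ω → Set (Particle d)} (hP : IsPoissonProcess μ (windowIntensity d F t) P)
    (hP' : IsPoissonProcess μ (windowIntensity d F t) P') {Q : ℕ → Finset (Fin d → ℤ)}
    (hQ : ∀ z : Fin d → ℤ, ∀ᶠ n in atTop, z ∈ Q n) :
    IdentDistrib (fun ω => seedDepth Q (P ω) t) (fun ω => seedDepth Q (P' ω) t) μ μ := by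
  have hD := measurable_measurableDepth Q
  have hconfig : IdentDistrib (fun ω => (⟨P ω⟩ : Config (Particle d))) (fun ω => ⟨P' ω⟩) μ μ :=
    ⟨hP.measurable_config.aemeasurable, hP'.measurable_config.aemeasurable,
      hP.map_config_eq hP'⟩
  have key : ∀ {P : Ω → Set (Particle d)}, IsPoissonProcess μ (windowIntensity d F t) P →
      IdentDistrib (fun ω => measurableDepth Q ⟨P ω⟩) (fun ω => seedDepth Q (P ω) t) μ μ := by
    intro P hP
    refine IdentDistrib.of_ae_eq (hD.comp hP.measurable_config).aemeasurable ?_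
    filter_upwards [hP.ae_isRegular hF] with ω hω
    exact (hω.seedDepth_eq hQ).symm
  exact (key hP).symm.trans ((hconfig.comp hD).trans (key hP'))

end Duality

end BallisticDeposition

end

open BallisticDeposition in
theorem proposition5p1 {Ω : Type*} [MeasurableSpace Ω] (μ : Measure Ω) [IsProbabilityMeasure μ]
    (d : ℕ) (hd : 1 ≤ d)
    (F : Measure ℝ) [IsProbabilityMeasure F] (Rmax : ℝ) (hF : ∀ᵐ r ∂F, 0 < r ∧ r ≤ Rmax)
    (P : Ω → Set (BallisticDeposition.Particle d))
    (hP : BallisticDeposition.IsPoissonProcess μ (BallisticDeposition.intensity d F) P)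
    (Q : ℕ → Finset (Fin d → ℤ)) (hQ : ∀ z : Fin d → ℤ, ∀ᶠ n in atTop, z ∈ Q n)
    (t : ℝ) (ht : 0 ≤ t) :
    -- the limit defining `H_t(0)` exists and is finite almost surely
    (∀ᵐ ω ∂μ, ∃ h : ℝ, BallisticDeposition.infiniteFlatHeight Q (P ω) t 0 = (h : EReal) ∧
      Tendsto (fun n => BallisticDeposition.flatHeight Q (P ω) t n 0) atTop (𝓝 (h : EReal))) ∧
    -- the limits defining the dual process exist almost surely, for all positions at once
    (∀ᵐ ω ∂μ, ∀ x : BallisticDeposition.Space d,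
      Tendsto (fun n => BallisticDeposition.seedHeight Q (P ω) t n x) atTop
        (𝓝 (BallisticDeposition.infiniteSeedHeight Q (P ω) t x))) ∧
    -- `H_t(0)` and `D̃_t` have the same distribution
    IdentDistrib (fun ω => BallisticDeposition.infiniteFlatHeight Q (P ω) t 0)
      (fun ω => BallisticDeposition.seedDepth Q (P ω) t) μ μ := by
  -- only the arrivals in `[0, t]` matter, and their intensity is invariant under `reflect t`
  have hW : MeasurableSet {p : Particle d | p.time ∈ Set.Icc 0 t} :=
    measurable_time measurableSet_Icc
  set S : Ω → Set (Particle d) := fun ω => P ω ∩ {p | p.time ∈ Set.Icc 0 t} with hSdef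
  have hS : IsPoissonProcess μ (windowIntensity d F t) S := by
    rw [← intensity_restrict]
    exact hP.restrict hW
  have hS' : IsPoissonProcess μ (windowIntensity d F t) fun ω => reflect t ⁻¹' S ω :=
    hS.preimage (reflect_reflect t) (measurePreserving_reflect F t)
  have hseed : ∀ ω n x, seedHeight Q (P ω) t n x = seedHeight Q (S ω) t n x := by
    intro ω n x
    rw [seedHeight, seedHeight, hSdef, restriction_inter_time]
  have hflat : ∀ ω n x, flatHeight Q (P ω) t n x = flatHeight Q (S ω) t n x := by
    intro ω n x
    rw [flatHeight, flatHeight, hSdef, restriction_inter_time]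
  simp only [seedDepth, infiniteSeedHeight, infiniteFlatHeight, hseed, hflat]
  refine ⟨?_, ?_, ?_⟩
  · filter_upwards [hS.ae_isRegular hF, hS'.ae_isRegular hF] with ω h h'
    obtain ⟨b, hb⟩ := h'.exists_seedDepth_eq hQ
    refine ⟨b, (h.infiniteFlatHeight_eq h' hQ).trans hb, tendsto_const_nhds.congr' ?_⟩
    filter_upwards [h.eventually_flatHeight_eq h' hQ] with n hn
    rw [hn, hb]
  · filter_upwards [hS.ae_isRegular hF] with ω h x
    exact h.tendsto_seedHeight hQ x
  · have hdual := hS'.identDistrib_seedDepth hF hS hQ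
    refine IdentDistrib.trans (IdentDistrib.of_ae_eq hdual.aemeasurable_fst ?_).symm hdual
    filter_upwards [hS.ae_isRegular hF, hS'.ae_isRegular hF] with ω h h'
    exact (h.infiniteFlatHeight_eq h' hQ).symm
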